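/- All operators are bounded linear operators on complex Hilbert spaces. Let $\pi(z_1,z_2)=(z_1+z_2,z_1z_2)$, $\mathbb G_2=\pi(\mathbb D^2)$, $\Gamma=\pi(\overline{\mathbb D}^2)$ and $b\Gamma=\pi(\mathbb T^2)$, and let $\partial\Gamma$ be the topological boundary of $\Gamma$ in $\mathbb C^2$. A polynomial $p\in\mathbb C[z_1,z_2]$ with zero set $Z(p)$ is called $\Gamma$-distinguished if $Z(p)\cap\mathbb G_2\neq\emptyset$ and $Z(p)\cap\partial\Gamma=Z(p)\cap b\Gamma$. A commuting pair $(S,P)$ of operators is a $\Gamma$-contraction if its Taylor joint spectrum $\sigma_T(S,P)$ is contained in $\Gamma$ and $\|f(S,P)\|\le\sup_{\Gamma}|f|$ for every rational function $f=p/q$ with $p,q\in\mathbb C[z_1,z_2]$ and $q$ without zeros in $\Gamma$. A $\Gamma$-contraction $(S,P)$ is called $\Gamma$-distinguished if $p(S,P)=0$ for some $\Gamma$-distinguished polynomial $p$. A $\Gamma$-unitary is a commuting pair of normal operators whose Taylor joint spectrum is contained in $b\Gamma$; a $\Gamma$-isometry is the restriction of a $\Gamma$-unitary to a joint invariant closed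 subspace; it is pure if $P^{*n}\to0$ strongly. For a contraction $P$ put $D_P=(I-P^*P)^{1/2}$ and $\mathcal D_P=\overline{\operatorname{Ran}}\,D_P$. The fundamental operator of a $\Gamma$-contraction $(S,P)$ is the unique operator $A$ on $\mathcal D_P$ with $S-S^*P=D_PAD_P$. Finally, $r$ denotes the spectral radius (with $r=0$ on the zero space). **Theorem.** Let $(S,P)$ be a pure $\Gamma$-isometry on a Hilbert space $\mathcal H$ such that $\dim\mathcal D_{P^*}<\infty$, and let $F_*\in\mathcal B(\mathcal D_{P^*})$ be the fundamental operator of $(S^*,P^*)$. Then the following are equivalent: 1. $(F_*,0)$ is $\Gamma$-distinguished; 2. $(S,P)$ is $\Gamma$-distinguished; 3. $r(F_*)<1$. Moreover, the polynomial $p(z_1,z_2)=\det(F_*^*+F_*z_2-z_1I)$ always satisfies $p(S,P)=0$, and if $\mathcal H\neq\{0\}$ and $r(F_*)<1$, then $p$ is $\Gamma$-distinguished. -/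

import Mathlib

open Filter Topology

noncomputable section

namespace SymBidisc

/-- The symmetrization map `π(z₁, z₂) = (z₁ + z₂, z₁ z₂)`. -/
def symm (z : ℂ × ℂ) : ℂ × ℂ := (z.1 + z.2, z.1 * z.2)

/-- The (open) symmetrized bidisc `𝔾₂ = π(𝔻²)`. -/
def G₂ : Set (ℂ × ℂ) := symm '' {z | ‖z.1‖ < 1 ∧ ‖z.2‖ < 1}

/-- The closed symmetrized bidisc `Γ`. -/
def Γ : Set (ℂ × ℂ) := symm '' {z | ‖z.1‖ ≤ 1 ∧ ‖z.2‖ ≤ 1}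

/-- The distinguished boundary `bΓ = π(𝕋²)`. -/
def bΓ : Set (ℂ × ℂ) := symm '' {z | ‖z.1‖ = 1 ∧ ‖z.2‖ = 1}

/-- The value at a point of a polynomial in `ℂ[z₁, z₂]`; the variable with index `0` is `z₁` and
the variable with index `1` is `z₂`. -/
def evalAt (p : MvPolynomial (Fin 2) ℂ) (z : ℂ × ℂ) : ℂ :=
  MvPolynomial.eval ![z.1, z.2] p

/-- The zero set `Z(p)` in `ℂ²`. -/
def zeroSet (p : MvPolynomial (Fin 2) ℂ) : Set (ℂ × ℂ) := {z | evalAt p z = 0}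

/-- `Γ`-distinguished polynomials. -/
def IsDistinguishedPoly (p : MvPolynomial (Fin 2) ℂ) : Prop :=
  (zeroSet p ∩ G₂).Nonempty ∧ zeroSet p ∩ frontier Γ = zeroSet p ∩ bΓ

section Pairs

variable {E : Type*} [NormedAddCommGroup E] [NormedSpace ℂ E]

/-- The operator `p(S, P) = ∑ a_{ij} Sⁱ Pʲ`, for a polynomial `p = ∑ a_{ij} z₁ⁱ z₂ʲ`. -/
def polyEval (p : MvPolynomial (Fin 2) ℂ) (S P : E →L[ℂ] E) : E →L[ℂ] E :=
  ∑ m ∈ p.support, p.coeff m • (S ^ m 0 * P ^ m 1)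

/-- The first map `x ↦ (A x, B x)` of the Koszul complex `0 → E → E × E → E → 0`. -/
def koszul₀ (A B : E →L[ℂ] E) : E →L[ℂ] E × E := A.prod B

/-- The second map `(x, y) ↦ A y - B x` of the Koszul complex. -/
def koszul₁ (A B : E →L[ℂ] E) : E × E →L[ℂ] E :=
  A ∘L ContinuousLinearMap.snd ℂ E E - B ∘L ContinuousLinearMap.fst ℂ E E

/-- Exactness of the Koszul complex `0 → E → E × E → E → 0` of `(A, B)`. -/
def KoszulExact (A B : E →L[ℂ] E) : Prop :=
  Function.Injective (koszul₀ A B) ∧ Function.Exact (koszul₀ A B) (koszul₁ A B) ∧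
    Function.Surjective (koszul₁ A B)

/-- The Taylor joint spectrum `σ_T(S, P)` (of a commuting pair). -/
def taylorSpectrum (S P : E →L[ℂ] E) : Set (ℂ × ℂ) :=
  {z | ¬ KoszulExact (S - z.1 • 1) (P - z.2 • 1)}

/-- `(S, P)` is a `Γ`-contraction: the operators commute, `σ_T(S, P) ⊆ Γ`, and von Neumann's
inequality `‖f(S, P)‖ ≤ sup_Γ |f|` holds for every rational function `f = p / q` without poles on
`Γ`, where `f(S, P) = p(S, P) q(S, P)⁻¹`. -/
def IsGammaContraction (S P : E →L[ℂ] E) : Prop :=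
  Commute S P ∧ taylorSpectrum S P ⊆ Γ ∧
    ∀ p q : MvPolynomial (Fin 2) ℂ, (∀ z ∈ Γ, evalAt q z ≠ 0) →
      IsUnit (polyEval q S P) ∧
        ‖polyEval p S P * Ring.inverse (polyEval q S P)‖ ≤
          sSup ((fun z => ‖evalAt p z / evalAt q z‖) '' Γ)

/-- `(S, P)` is a `Γ`-distinguished `Γ`-contraction. -/
def IsGammaDistinguished (S P : E →L[ℂ] E) : Prop :=
  IsGammaContraction S P ∧
    ∃ p : MvPolynomial (Fin 2) ℂ, IsDistinguishedPoly p ∧ polyEval p S P = 0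

end Pairs

section Hilbert

universe u

/-- `(T, U)` is a `Γ`-unitary. -/
def IsGammaUnitary {K : Type u} [NormedAddCommGroup K] [InnerProductSpace ℂ K] [CompleteSpace K]
    (T U : K →L[ℂ] K) : Prop :=
  Commute T U ∧ IsStarNormal T ∧ IsStarNormal U ∧ taylorSpectrum T U ⊆ bΓ

/-- `(S, P)` is a `Γ`-isometry: the restriction of a `Γ`-unitary to a joint invariant subspace,
the inclusion of the subspace being given by a linear isometry `J`. -/
def IsGammaIsometry {H : Type u} [NormedAddCommGroup H] [InnerProductSpace ℂ H] [CompleteSpace H]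
    (S P : H →L[ℂ] H) : Prop :=
  ∃ (K : Type u) (_ : NormedAddCommGroup K) (_ : InnerProductSpace ℂ K) (_ : CompleteSpace K)
    (T U : K →L[ℂ] K) (J : H →ₗᵢ[ℂ] K),
    IsGammaUnitary T U ∧ (∀ x, J (S x) = T (J x)) ∧ ∀ x, J (P x) = U (J x)

variable {H : Type u} [NormedAddCommGroup H] [InnerProductSpace ℂ H] [CompleteSpace H]

/-- `P^{*n} → 0` strongly. -/
def IsPure (P : H →L[ℂ] H) : Prop :=
  ∀ x, Tendsto (fun n : ℕ => (ContinuousLinearMap.adjoint P ^ n) x) atTop (𝓝 0)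

/-- `(S, P)` is a pure `Γ`-isometry. -/
def IsPureGammaIsometry (S P : H →L[ℂ] H) : Prop :=
  IsGammaIsometry S P ∧ IsPure P

/-- The defect operator `D_P = (I - P* P)^{1/2}` of a contraction `P`. -/
def defectOp (P : H →L[ℂ] H) : H →L[ℂ] H :=
  CFC.sqrt (1 - ContinuousLinearMap.adjoint P * P)

/-- The defect space `𝓓_P`, the closure of the range of `D_P`. -/
abbrev defectSpace (P : H →L[ℂ] H) : Submodule ℂ H :=
  (LinearMap.range (defectOp P : H →ₗ[ℂ] H)).topologicalClosure

/-- `D_P` as an operator from `H` to `𝓓_P`. -/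
def defectOpTo (P : H →L[ℂ] H) : H →L[ℂ] defectSpace P :=
  (defectOp P).codRestrict (defectSpace P) fun x =>
    Submodule.le_topologicalClosure _ (LinearMap.mem_range_self _ x)

/-- `A ∈ 𝓑(𝓓_P)` is the fundamental operator of `(S, P)`, i.e. the (necessarily unique) solution of
`S - S* P = D_P A D_P`. -/
def IsFundamentalOperator (S P : H →L[ℂ] H) (A : defectSpace P →L[ℂ] defectSpace P) : Prop :=
  S - ContinuousLinearMap.adjoint S * P =
    defectOp P ∘L (defectSpace P).subtypeL ∘L A ∘L defectOpTo P

end Hilbert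

section Determinant

variable {V : Type*} [NormedAddCommGroup V] [InnerProductSpace ℂ V] [CompleteSpace V]
  [FiniteDimensional ℂ V]

/-- The matrix of an operator in a fixed basis of the finite-dimensional space `V`. -/
def matrixOf (F : V →L[ℂ] V) :
    Matrix (Fin (Module.finrank ℂ V)) (Fin (Module.finrank ℂ V)) ℂ :=
  LinearMap.toMatrix (Module.finBasis ℂ V) (Module.finBasis ℂ V) (F : V →ₗ[ℂ] V)

/-- The polynomial `det(F* + F z₂ - z₁ I)` in `ℂ[z₁, z₂]`. -/
def detPoly (F : V →L[ℂ] V) : MvPolynomial (Fin 2) ℂ :=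
  Matrix.det (R := MvPolynomial (Fin 2) ℂ)
    ((matrixOf (ContinuousLinearMap.adjoint F)).map MvPolynomial.C
      + (MvPolynomial.X 1 : MvPolynomial (Fin 2) ℂ) • (matrixOf F).map MvPolynomial.C
      - Matrix.scalar _ (MvPolynomial.X 0 : MvPolynomial (Fin 2) ℂ))

/-- The values of `detPoly F` are the (basis-independent) determinants of `F* + z₂ F - z₁ I`. -/
theorem evalAt_detPoly (F : V →L[ℂ] V) (z : ℂ × ℂ) :
    evalAt (detPoly F) z =
      LinearMap.det ((ContinuousLinearMap.adjoint F + z.2 • F - z.1 • 1 : V →L[ℂ] V) :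
        V →ₗ[ℂ] V) := by
  rw [← LinearMap.det_toMatrix (Module.finBasis ℂ V), evalAt, detPoly, RingHom.map_det]
  congr 1
  ext i j
  simp only [RingHom.mapMatrix_apply, Matrix.map_apply, Matrix.add_apply, Matrix.sub_apply,
    Matrix.smul_apply, matrixOf, LinearMap.toMatrix_apply, Matrix.scalar_apply,
    Matrix.diagonal_apply]
  by_cases h : i = j
  · subst h; simp
  · simp [h]

end Determinant

end SymBidisc

end

/-!
Let `V` be the defect space of `P*`. A `Γ`-isometry satisfies `P* P = 1`, `S = S* P` and
`‖S‖ ≤ 2`, so that `V = ker P*` and the fundamental operator `F` of `(S*, P*)` is the restriction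
of `S*` to `V`. Hence `(F, 0)` is the restriction of `(S*, P*)` to a joint invariant subspace,
and `S v = P F v + F* v` for `v ∈ V`. These two facts replace the Toeplitz model of `(S, P)` on a
vector-valued Hardy space.

*The determinant annihilates the pair.* The relation `S v = P F v + F* v` says that the polynomial
matrix `F* + z₂ F - z₁` annihilates a basis of `V`; multiplying by the adjugate shows that its
determinant annihilates `V` (`polyEval_detPoly_apply_eq_zero`), and purity of `P` carries this over
to the whole space (`eq_zero_of_commute_of_isPure`).

*The determinant is distinguished if `r(F) < 1`.* The numerical radius of `F` is at most one
(`norm_star_apply_le_of_norm_lt_one`). At a zero `(z + w, zw)` of the determinant with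
`|z| = 1 > |w|`, a vector `v` in the kernel of `F* + zw F - (z + w)` must satisfy
`⟨v, F v⟩ = z⁻¹ ‖v‖²`; this extremal value forces `F v = z⁻¹ v`
(`apply_eq_smul_of_numericalRadius_le_one`), which contradicts `r(F) < 1`.

*The equivalences.* If a distinguished polynomial `p` annihilates `(S, P)`, then the polynomial
with the conjugate coefficients annihilates `(S*, P*)`, hence `(F, 0)`. If it annihilates `(F, 0)`,
then it vanishes at `(c, 0)` for every eigenvalue `c` of `F`; as `(c, 0)` lies in `Γ`, and in
`∂Γ \ bΓ` if `|c| = 1`, all eigenvalues are of modulus less than one.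

The `Γ`-contractivity of all pairs involved goes back to `Γ`-unitaries. The characters of the
C⋆-algebra generated by a `Γ`-unitary lie in its Taylor spectrum, hence in `bΓ`
(`IsGammaUnitary.exists_gelfand`), which gives von Neumann's inequality. It passes to adjoints and
to restrictions (`IsGammaContraction.adjoint`, `IsGammaContraction.restrict`), where the spectral
inclusion is recovered from the polynomial convexity of `Γ`
(`taylorSpectrum_subset_Γ_and_isUnit`).
-/

namespace SymBidisc

open ComplexConjugate ContinuousLinearMap

universe u

/-! ### The geometry of the symmetrized bidisc -/

theorem continuous_symm : Continuous symm := by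
  unfold symm; fun_prop

theorem isCompact_Γ : IsCompact Γ := by
  have h : {z : ℂ × ℂ | ‖z.1‖ ≤ 1 ∧ ‖z.2‖ ≤ 1} =
      Metric.closedBall (0 : ℂ) 1 ×ˢ Metric.closedBall (0 : ℂ) 1 := by
    ext z; simp
  rw [Γ, h]
  exact ((isCompact_closedBall _ _).prod (isCompact_closedBall _ _)).image continuous_symm

theorem frontier_Γ_subset : frontier Γ ⊆ Γ := isCompact_Γ.isClosed.frontier_subset

theorem G₂_subset_Γ : G₂ ⊆ Γ := Set.image_mono fun _ h => ⟨h.1.le, h.2.le⟩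

theorem bΓ_subset_Γ : bΓ ⊆ Γ := Set.image_mono fun _ h => ⟨h.1.le, h.2.le⟩

theorem zero_mem_G₂ : (0 : ℂ × ℂ) ∈ G₂ := ⟨0, by simp, by simp [symm]⟩

/-- Every point of `ℂ²` is the image under `π` of the pair of roots of `t² - st + p`. -/
theorem exists_symm_eq (x : ℂ × ℂ) : ∃ z, symm z = x := by
  obtain ⟨d, hd⟩ := IsAlgClosed.exists_pow_nat_eq (x.1 ^ 2 - 4 * x.2) (n := 2) (by norm_num)
  refine ⟨((x.1 + d) / 2, (x.1 - d) / 2), Prod.ext ?_ ?_⟩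
  · simp only [symm]; ring
  · simp only [symm]; linear_combination (-1 / 4) * hd

theorem symm_swap (z w : ℂ) : symm (z, w) = symm (w, z) := by
  simp [symm, add_comm, mul_comm]

/-- The entries of a pair are determined up to order by the image of the pair under `π`. -/
theorem eq_or_eq_of_symm_eq {z w z' w' : ℂ} (h : symm (z, w) = symm (z', w')) :
    z = z' ∧ w = w' ∨ z = w' ∧ w = z' := by
  simp only [symm, Prod.mk.injEq] at h
  obtain ⟨h1, h2⟩ := h
  have h3 : (z - z') * (z - w') = 0 := by linear_combination z * h1 - h2
  rcases mul_eq_zero.1 h3 with h4 | h4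
  · exact .inl ⟨by linear_combination h4, by linear_combination h1 - h4⟩
  · exact .inr ⟨by linear_combination h4, by linear_combination h1 - h4⟩

theorem symm_mem_Γ {z w : ℂ} : symm (z, w) ∈ Γ ↔ ‖z‖ ≤ 1 ∧ ‖w‖ ≤ 1 := by
  refine ⟨?_, fun h => ⟨(z, w), h, rfl⟩⟩
  rintro ⟨⟨z', w'⟩, h, h'⟩
  rcases eq_or_eq_of_symm_eq h' with ⟨rfl, rfl⟩ | ⟨rfl, rfl⟩
  exacts [h, h.symm]

theorem norm_fst_le_two_of_mem_Γ {x : ℂ × ℂ} (hx : x ∈ Γ) : ‖x.1‖ ≤ 2 := by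
  obtain ⟨⟨z, w⟩, ⟨h1, h2⟩, rfl⟩ := hx
  refine (norm_add_le z w).trans ?_
  dsimp only at h1 h2; linarith

theorem norm_snd_le_one_of_mem_Γ {x : ℂ × ℂ} (hx : x ∈ Γ) : ‖x.2‖ ≤ 1 := by
  obtain ⟨⟨z, w⟩, ⟨h1, h2⟩, rfl⟩ := hx
  simpa [symm] using mul_le_one₀ h1 (norm_nonneg w) h2

theorem norm_snd_eq_one_of_mem_bΓ {x : ℂ × ℂ} (hx : x ∈ bΓ) : ‖x.2‖ = 1 := by
  obtain ⟨⟨z, w⟩, ⟨h1, h2⟩, rfl⟩ := hx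
  dsimp only at h1 h2
  simp [symm, h1, h2]

/-- On `bΓ` the first coordinate is `z + w = conj (z + w) * (z * w)`. -/
theorem fst_eq_of_mem_bΓ {x : ℂ × ℂ} (hx : x ∈ bΓ) : x.1 = conj x.1 * x.2 := by
  obtain ⟨⟨z, w⟩, ⟨h1, h2⟩, rfl⟩ := hx
  dsimp only at h1 h2
  have hz : conj z * z = 1 := by rw [Complex.conj_mul', h1]; simp
  have hw : conj w * w = 1 := by rw [Complex.conj_mul', h2]; simp
  simp only [symm, map_add]
  linear_combination (-w) * hz + (-z) * hw

/-- Membership in `𝔾₂` as a strict inequality in the coordinates. For `x = π(z, w)` and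
`|z|, |w| ≤ 1`, the left-hand side is at most `(|z| + |w|) (1 - |zw|)`, and
`1 + |zw| - |z| - |w| = (1 - |z|) (1 - |w|)`. -/
theorem mem_G₂_iff (x : ℂ × ℂ) : x ∈ G₂ ↔ ‖x.1 - conj x.1 * x.2‖ < 1 - ‖x.2‖ ^ 2 := by
  have key : ∀ z w : ℂ, (z + w) - conj (z + w) * (z * w) =
      z * ((1 - ‖w‖ ^ 2 : ℝ) : ℂ) + w * ((1 - ‖z‖ ^ 2 : ℝ) : ℂ) := by
    intro z w
    push_cast
    rw [← Complex.conj_mul' z, ← Complex.conj_mul' w, map_add]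
    ring
  constructor
  · rintro ⟨⟨z, w⟩, ⟨h1, h2⟩, rfl⟩
    dsimp only at h1 h2
    simp only [symm]
    rw [key, norm_mul]
    have hz := norm_nonneg z
    have hw := norm_nonneg w
    calc _ ≤ ‖z‖ * (1 - ‖w‖ ^ 2) + ‖w‖ * (1 - ‖z‖ ^ 2) := by
          refine (norm_add_le _ _).trans ?_
          rw [norm_mul, norm_mul, Complex.norm_of_nonneg (by nlinarith),
            Complex.norm_of_nonneg (by nlinarith)]
      _ = (‖z‖ + ‖w‖) * (1 - ‖z‖ * ‖w‖) := by ring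
      _ < (1 + ‖z‖ * ‖w‖) * (1 - ‖z‖ * ‖w‖) := by
          apply mul_lt_mul_of_pos_right <;> nlinarith
      _ = _ := by ring
  · obtain ⟨⟨z, w⟩, rfl⟩ := exists_symm_eq x
    -- if the root `z` is outside the disc, `(|z| + |w|) (1 - |zw|)` is a lower bound instead
    have main : ∀ z w : ℂ, ‖(z + w) - conj (z + w) * (z * w)‖ < 1 - ‖z * w‖ ^ 2 → ‖z‖ < 1 := by
      intro z w h
      by_contra! h1
      have hw := norm_nonneg w
      rw [key, norm_mul] at h
      have hzw : ‖z‖ * ‖w‖ < 1 := by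
        have h3 := (norm_nonneg _).trans_lt h
        nlinarith [mul_nonneg (norm_nonneg z) hw]
      have hw1 : ‖w‖ < 1 := by nlinarith
      have h2 : ‖z‖ * (1 - ‖w‖ ^ 2) - ‖w‖ * (‖z‖ ^ 2 - 1) ≤
          ‖z * ((1 - ‖w‖ ^ 2 : ℝ) : ℂ) + w * ((1 - ‖z‖ ^ 2 : ℝ) : ℂ)‖ := by
        have := norm_sub_le_norm_add (z * ((1 - ‖w‖ ^ 2 : ℝ) : ℂ)) (w * ((1 - ‖z‖ ^ 2 : ℝ) : ℂ))
        rw [norm_mul, norm_mul, Complex.norm_of_nonneg (by nlinarith), Complex.norm_real,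
          Real.norm_of_nonpos (by nlinarith)] at this
        linarith
      have h4 : (‖z‖ + ‖w‖) * (1 - ‖z‖ * ‖w‖) < (1 + ‖z‖ * ‖w‖) * (1 - ‖z‖ * ‖w‖) := by
        nlinarith
      have h5 := lt_of_mul_lt_mul_right h4 (by linarith)
      nlinarith
    intro h
    simp only [symm] at h
    refine ⟨(z, w), ⟨main z w h, main w z ?_⟩, rfl⟩
    rwa [add_comm w z, mul_comm w z]

theorem isOpen_G₂ : IsOpen G₂ := by
  have h : G₂ = {x : ℂ × ℂ | ‖x.1 - conj x.1 * x.2‖ < 1 - ‖x.2‖ ^ 2} := Set.ext mem_G₂_iff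
  rw [h]
  exact isOpen_lt (by fun_prop) (by fun_prop)

/-- A boundary point of `Γ` is `π(z, w)` with a unimodular `z`. -/
theorem exists_symm_eq_of_mem_frontier {x : ℂ × ℂ} (hx : x ∈ frontier Γ) :
    ∃ z w : ℂ, ‖z‖ = 1 ∧ ‖w‖ ≤ 1 ∧ symm (z, w) = x := by
  obtain ⟨⟨z, w⟩, ⟨h1, h2⟩, rfl⟩ := frontier_Γ_subset hx
  dsimp only at h1 h2
  rcases h1.eq_or_lt with h1' | h1'
  · exact ⟨z, w, h1', h2, rfl⟩
  rcases h2.eq_or_lt with h2' | h2'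
  · exact ⟨w, z, h2', h1, symm_swap w z⟩
  · exact (hx.2 (interior_maximal G₂_subset_Γ isOpen_G₂ ⟨(z, w), ⟨h1', h2'⟩, rfl⟩)).elim

/-- If `|z| = 1`, then `π(z, w)` is approximated from outside `Γ` by the points `π(tz, w)`,
`t > 1`. -/
theorem symm_mem_frontier {z w : ℂ} (hz : ‖z‖ = 1) (hw : ‖w‖ ≤ 1) :
    symm (z, w) ∈ frontier Γ := by
  refine ⟨subset_closure (symm_mem_Γ.2 ⟨hz.le, hw⟩), fun h => ?_⟩
  have hc : ContinuousAt (fun t : ℝ => symm ((t : ℂ) * z, w)) 1 :=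
    (continuous_symm.comp (by fun_prop)).continuousAt
  have hn : Γ ∈ 𝓝 (symm (((1 : ℝ) : ℂ) * z, w)) := by
    simpa using mem_interior_iff_mem_nhds.1 h
  obtain ⟨t, ht, ht1⟩ := (((hc.eventually_mem hn).filter_mono nhdsWithin_le_nhds).and
    (self_mem_nhdsWithin (s := Set.Ioi (1 : ℝ)))).exists
  have := (symm_mem_Γ.1 ht).1
  rw [norm_mul, hz, Complex.norm_of_nonneg (zero_le_one.trans (le_of_lt ht1))] at this
  have ht2 : (1 : ℝ) < t := ht1
  linarith

theorem bΓ_subset_frontier : bΓ ⊆ frontier Γ := by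
  rintro _ ⟨⟨z, w⟩, ⟨h1, h2⟩, rfl⟩
  exact symm_mem_frontier h1 (le_of_eq h2)

theorem mk_zero_eq_symm (a : ℂ) : (a, (0 : ℂ)) = symm (a, 0) := by simp [symm]

theorem mk_zero_notMem_bΓ (a : ℂ) : (a, (0 : ℂ)) ∉ bΓ := fun h => by
  simpa using norm_snd_eq_one_of_mem_bΓ h

/-! ### Polynomials on the symmetrized bidisc -/

/-- The polynomial `r` with `r(z + w, zw) = zⁿ + wⁿ`, given by Newton's recursion. -/
noncomputable def powerSum : ℕ → MvPolynomial (Fin 2) ℂ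
  | 0 => 2
  | 1 => MvPolynomial.X 0
  | n + 2 => MvPolynomial.X 0 * powerSum (n + 1) - MvPolynomial.X 1 * powerSum n

theorem evalAt_powerSum (z w : ℂ) : ∀ n, evalAt (powerSum n) (symm (z, w)) = z ^ n + w ^ n
  | 0 => by simp only [evalAt, powerSum, map_ofNat, pow_zero]; norm_num
  | 1 => by simp [evalAt, powerSum, symm]
  | n + 2 => by
    have h1 := evalAt_powerSum z w (n + 1)
    have h2 := evalAt_powerSum z w n
    simp only [evalAt] at h1 h2
    simp only [evalAt, powerSum, map_sub, map_mul, h1, h2]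
    simp only [MvPolynomial.eval_X, symm, Matrix.cons_val_zero, Matrix.cons_val_one]
    ring

theorem continuous_evalAt (p : MvPolynomial (Fin 2) ℂ) : Continuous (evalAt p) := by
  have h : evalAt p = fun z => MvPolynomial.eval ![z.1, z.2] p := rfl
  rw [h]
  refine (MvPolynomial.continuous_eval p).comp (continuous_pi fun i => ?_)
  fin_cases i <;> simp <;> fun_prop

/-- `Γ` is polynomially convex. The polynomials needed to separate a point from `Γ` are the
product `zw` and the power sums `zⁿ + wⁿ`. -/
theorem mem_Γ_of_forall_poly {x : ℂ × ℂ}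
    (h : ∀ (p : MvPolynomial (Fin 2) ℂ) (M : ℝ), (∀ y ∈ Γ, ‖evalAt p y‖ ≤ M) →
      ‖evalAt p x‖ ≤ M) : x ∈ Γ := by
  obtain ⟨⟨z, w⟩, rfl⟩ := exists_symm_eq x
  have hprod : ‖z‖ * ‖w‖ ≤ 1 := by
    have := h (MvPolynomial.X 1) 1 fun y hy => by
      simpa [evalAt] using norm_snd_le_one_of_mem_Γ hy
    simpa [evalAt, symm] using this
  have hsum : ∀ n, ‖z ^ n + w ^ n‖ ≤ 2 := fun n => by
    have := h (powerSum n) 2 fun y hy => by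
      obtain ⟨⟨a, b⟩, ⟨ha, hb⟩, rfl⟩ := hy
      rw [evalAt_powerSum]
      refine (norm_add_le _ _).trans ?_
      rw [norm_pow, norm_pow]
      linarith [pow_le_one₀ (n := n) (norm_nonneg a) ha, pow_le_one₀ (n := n) (norm_nonneg b) hb]
    rwa [evalAt_powerSum] at this
  have main : ∀ z w : ℂ, ‖z‖ * ‖w‖ ≤ 1 → (∀ n, ‖z ^ n + w ^ n‖ ≤ 2) → ‖z‖ ≤ 1 := by
    intro z w hp hs
    by_contra! hz
    have hw : ‖w‖ ≤ 1 := by nlinarith [norm_nonneg w]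
    obtain ⟨n, hn⟩ := pow_unbounded_of_one_lt 3 hz
    have h1 := norm_sub_le_norm_add (z ^ n) (w ^ n)
    rw [norm_pow, norm_pow] at h1
    linarith [hs n, pow_le_one₀ (n := n) (norm_nonneg w) hw]
  exact symm_mem_Γ.2 ⟨main z w hprod hsum,
    main w z (by rwa [mul_comm]) fun n => by rw [add_comm]; exact hsum n⟩

/-- The polynomial with the conjugate coefficients. -/
noncomputable def conjPoly (p : MvPolynomial (Fin 2) ℂ) : MvPolynomial (Fin 2) ℂ :=
  MvPolynomial.map (starRingEnd ℂ) p

theorem evalAt_conjPoly (p : MvPolynomial (Fin 2) ℂ) (x : ℂ × ℂ) :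
    evalAt (conjPoly p) x = conj (evalAt p (conj x.1, conj x.2)) := by
  rw [evalAt, conjPoly, MvPolynomial.eval_map]
  simp [evalAt, MvPolynomial.eval₂_eq', MvPolynomial.eval_eq', Fin.prod_univ_two]

theorem conjPoly_conjPoly (p : MvPolynomial (Fin 2) ℂ) : conjPoly (conjPoly p) = p := by
  rw [conjPoly, conjPoly, MvPolynomial.map_map]
  convert MvPolynomial.map_id p
  ext; simp

theorem conj_mem_Γ {x : ℂ × ℂ} (hx : x ∈ Γ) : (conj x.1, conj x.2) ∈ Γ := by
  obtain ⟨⟨z, w⟩, ⟨h1, h2⟩, rfl⟩ := hx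
  exact ⟨(conj z, conj w), ⟨by simpa using h1, by simpa using h2⟩, by simp [symm]⟩

theorem conj_mem_frontier_Γ {x : ℂ × ℂ} (hx : x ∈ frontier Γ) :
    (conj x.1, conj x.2) ∈ frontier Γ := by
  obtain ⟨z, w, h1, h2, rfl⟩ := exists_symm_eq_of_mem_frontier hx
  have h := symm_mem_frontier (z := conj z) (w := conj w) (by simpa using h1) (by simpa using h2)
  simpa [symm] using h

theorem conj_mem_bΓ {x : ℂ × ℂ} (hx : x ∈ bΓ) : (conj x.1, conj x.2) ∈ bΓ := by
  obtain ⟨⟨z, w⟩, ⟨h1, h2⟩, rfl⟩ := hx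
  exact ⟨(conj z, conj w), ⟨by simpa using h1, by simpa using h2⟩, by simp [symm]⟩

theorem conj_mem_G₂ {x : ℂ × ℂ} (hx : x ∈ G₂) : (conj x.1, conj x.2) ∈ G₂ := by
  obtain ⟨⟨z, w⟩, ⟨h1, h2⟩, rfl⟩ := hx
  exact ⟨(conj z, conj w), ⟨by simpa using h1, by simpa using h2⟩, by simp [symm]⟩

/-- Only one inclusion in the definition of a `Γ`-distinguished polynomial has content, since
`bΓ ⊆ ∂Γ`. -/
theorem isDistinguishedPoly_iff {p : MvPolynomial (Fin 2) ℂ} :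
    IsDistinguishedPoly p ↔
      (∃ x ∈ G₂, evalAt p x = 0) ∧ ∀ x ∈ frontier Γ, evalAt p x = 0 → x ∈ bΓ := by
  constructor
  · rintro ⟨⟨x, hx, hx'⟩, h⟩
    exact ⟨⟨x, hx', hx⟩, fun y hy hy' => (h.le ⟨hy', hy⟩).2⟩
  · rintro ⟨⟨x, hx', hx⟩, h⟩
    exact ⟨⟨x, hx, hx'⟩, Set.Subset.antisymm (fun y hy => ⟨hy.1, h y hy.2 hy.1⟩)
      fun y hy => ⟨hy.1, bΓ_subset_frontier hy.2⟩⟩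

theorem IsDistinguishedPoly.conjPoly {p : MvPolynomial (Fin 2) ℂ} (hp : IsDistinguishedPoly p) :
    IsDistinguishedPoly (conjPoly p) := by
  rw [isDistinguishedPoly_iff] at hp ⊢
  obtain ⟨⟨x, hx, hx'⟩, h⟩ := hp
  refine ⟨⟨_, conj_mem_G₂ hx, by simp [evalAt_conjPoly, hx']⟩, fun y hy hy' => ?_⟩
  have := conj_mem_bΓ (h _ (conj_mem_frontier_Γ hy) (by simpa [evalAt_conjPoly] using hy'))
  simpa using this

/-- The boundary points `(a, 0)`, `|a| = 1`, of `Γ` do not belong to `bΓ`. -/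
theorem IsDistinguishedPoly.evalAt_mk_zero_ne_zero {p : MvPolynomial (Fin 2) ℂ}
    (hp : IsDistinguishedPoly p) {a : ℂ} (ha : ‖a‖ = 1) : evalAt p (a, 0) ≠ 0 := fun h =>
  mk_zero_notMem_bΓ a ((isDistinguishedPoly_iff.1 hp).2 _
    (mk_zero_eq_symm a ▸ symm_mem_frontier ha (by simp)) h)

theorem isDistinguishedPoly_X_zero : IsDistinguishedPoly (MvPolynomial.X 0) := by
  rw [isDistinguishedPoly_iff]
  refine ⟨⟨0, zero_mem_G₂, by simp [evalAt]⟩, fun x hx h => ?_⟩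
  obtain ⟨z, w, hz, -, rfl⟩ := exists_symm_eq_of_mem_frontier hx
  have hw : w = -z := by
    simp only [evalAt, symm, MvPolynomial.eval_X, Matrix.cons_val_zero] at h
    linear_combination h
  exact ⟨(z, w), ⟨hz, by simp [hw, hz]⟩, rfl⟩

/-! ### The polynomial functional calculus -/

section PolyEval

variable {E : Type*} [NormedAddCommGroup E] [NormedSpace ℂ E]

/-- The map `p ↦ p(S, P)` comes from evaluation in any commutative algebra that contains preimages
of `S` and `P`. -/
theorem polyEval_map {C : Type*} [CommRing C] [Algebra ℂ C] (φ : C →ₐ[ℂ] (E →L[ℂ] E)) (a b : C)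
    (p : MvPolynomial (Fin 2) ℂ) :
    polyEval p (φ a) (φ b) = φ (MvPolynomial.aeval ![a, b] p) := by
  simp [polyEval, MvPolynomial.aeval_def, MvPolynomial.eval₂_eq', Fin.prod_univ_two,
    Algebra.smul_def]

theorem evalAt_eq_map_aeval {C : Type*} [CommRing C] [Algebra ℂ C] (χ : C →ₐ[ℂ] ℂ) (a b : C)
    (p : MvPolynomial (Fin 2) ℂ) :
    χ (MvPolynomial.aeval ![a, b] p) = evalAt p (χ a, χ b) := by
  simp [evalAt, MvPolynomial.aeval_def, MvPolynomial.eval₂_eq', Fin.prod_univ_two,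
    MvPolynomial.eval_eq']

/-- The closed subalgebra generated by two commuting operators, as an abstract commutative Banach
algebra. -/
theorem exists_commutative_banach_algebra {E : Type u} [NormedAddCommGroup E]
    [NormedSpace ℂ E] [CompleteSpace E] {S P : E →L[ℂ] E} (h : Commute S P) :
    ∃ (C : Type u) (_ : NormedCommRing C) (_ : NormedAlgebra ℂ C) (_ : CompleteSpace C)
      (φ : C →ₐ[ℂ] (E →L[ℂ] E)) (a b : C), φ a = S ∧ φ b = P ∧ ∀ c, ‖φ c‖ = ‖c‖ := by
  let B : Subalgebra ℂ (E →L[ℂ] E) := Algebra.adjoin ℂ {S, P}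
  have hB : ∀ x y : B, x * y = y * x := by
    have : ∀ x ∈ ({S, P} : Set (E →L[ℂ] E)), ∀ y ∈ ({S, P} : Set (E →L[ℂ] E)), x * y = y * x := by
      rintro x (rfl | rfl) y (rfl | rfl)
      exacts [rfl, h.eq, h.eq.symm, rfl]
    exact fun x y => (Algebra.isMulCommutative_adjoin ℂ this).is_comm.comm x y
  let C := B.topologicalClosure
  let _ : NormedCommRing C :=
    { (inferInstance : NormedRing C) with
      mul_comm := (B.commRingTopologicalClosure hB).mul_comm }
  refine ⟨C, inferInstance, inferInstance, B.isClosed_topologicalClosure.completeSpace_coe, C.val,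
    ⟨S, B.le_topologicalClosure (Algebra.subset_adjoin (by simp))⟩,
    ⟨P, B.le_topologicalClosure (Algebra.subset_adjoin (by simp))⟩, rfl, rfl, fun _ => rfl⟩

theorem polyEval_commute {S P : E →L[ℂ] E} (h : Commute S P) (p q : MvPolynomial (Fin 2) ℂ) :
    Commute (polyEval p S P) (polyEval q S P) := by
  refine Commute.sum_left _ _ _ fun i _ => Commute.sum_right _ _ _ fun j _ => ?_
  refine Commute.smul_left (Commute.smul_right ?_ _) _
  exact ((((Commute.refl S).pow_pow _ _).mul_right (h.pow_pow _ _))).mul_left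
    ((h.symm.pow_pow _ _).mul_right ((Commute.refl P).pow_pow _ _))

theorem polyEval_C (c : ℂ) (S P : E →L[ℂ] E) : polyEval (MvPolynomial.C c) S P = c • 1 := by
  by_cases hc : c = 0
  · simp [polyEval, hc]
  · rw [polyEval, MvPolynomial.C_apply, MvPolynomial.support_monomial, if_neg hc,
      Finset.sum_singleton]
    simp

theorem polyEval_one (S P : E →L[ℂ] E) : polyEval 1 S P = 1 := by
  simpa using polyEval_C 1 S P

theorem polyEval_X_zero (S P : E →L[ℂ] E) : polyEval (MvPolynomial.X 0) S P = S := by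
  simp [polyEval, MvPolynomial.X, MvPolynomial.support_monomial]

theorem polyEval_intertwine {E' : Type*} [NormedAddCommGroup E'] [NormedSpace ℂ E']
    {S P : E →L[ℂ] E} {T U : E' →L[ℂ] E'} {J : E →ₗ[ℂ] E'} (hS : ∀ x, J (S x) = T (J x))
    (hP : ∀ x, J (P x) = U (J x)) (p : MvPolynomial (Fin 2) ℂ) (x : E) :
    J (polyEval p S P x) = polyEval p T U (J x) := by
  have key : ∀ {A : E →L[ℂ] E} {B : E' →L[ℂ] E'}, (∀ x, J (A x) = B (J x)) →
      ∀ (n : ℕ) x, J ((A ^ n) x) = (B ^ n) (J x) := by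
    intro A B h n
    induction n with
    | zero => simp
    | succ n ih => intro x; rw [pow_succ, pow_succ, mul_apply_eq_comp, mul_apply_eq_comp, ih, h]
  simp only [polyEval, sum_apply, smul_apply, mul_apply_eq_comp, map_sum, map_smul, key hS, key hP]

/-- Evaluation at an eigenvector of `A`, for a pair `(A, 0)`. -/
theorem polyEval_zero_apply_eigenvector {A : E →L[ℂ] E} {c : ℂ} {v : E} (hv : A v = c • v)
    (p : MvPolynomial (Fin 2) ℂ) : polyEval p A 0 v = evalAt p (c, 0) • v := by
  have h := polyEval_intertwine (S := c • (1 : ℂ →L[ℂ] ℂ)) (P := 0) (T := A) (U := 0)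
    (J := LinearMap.toSpanSingleton ℂ E v) (fun x => by simp [hv, smul_smul, mul_comm])
    (fun x => by simp) p 1
  rw [LinearMap.toSpanSingleton_apply, LinearMap.toSpanSingleton_apply, one_smul] at h
  rw [← h]
  congr 1
  rw [polyEval, evalAt, MvPolynomial.eval_eq']
  simp only [sum_apply, smul_apply, mul_apply_eq_comp, Fin.prod_univ_two]
  refine Finset.sum_congr rfl fun m _ => ?_
  rcases eq_or_ne (m 1) 0 with h0 | h0 <;> simp [h0, smul_pow]

end PolyEval

theorem adjoint_polyEval {H : Type*} [NormedAddCommGroup H] [InnerProductSpace ℂ H]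
    [CompleteSpace H] {S P : H →L[ℂ] H} (h : Commute S P) (p : MvPolynomial (Fin 2) ℂ) :
    adjoint (polyEval p S P) = polyEval (conjPoly p) (adjoint S) (adjoint P) := by
  have h' : Commute (star S) (star P) := h.star_star
  have hs : (conjPoly p).support = p.support :=
    MvPolynomial.support_map_of_injective _ (starRingEnd ℂ).injective
  simp only [← star_eq_adjoint]
  rw [polyEval, polyEval, hs, star_sum]
  refine Finset.sum_congr rfl fun m _ => ?_
  rw [star_smul, star_mul, star_pow, star_pow, (h'.pow_pow _ _).eq]
  simp [conjPoly, MvPolynomial.coeff_map]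

/-! ### Criteria for `Γ`-contractions -/

section Criteria

variable {E : Type*} [NormedAddCommGroup E] [NormedSpace ℂ E]

/-- If `1` is in the ideal generated by `A` and `B` in a commutative algebra of operators, then the
Koszul complex is exact. -/
theorem koszulExact_of_mul_add_mul_eq_one {A B A' B' : E →L[ℂ] E} (hAB : Commute A B)
    (hAA : Commute A A') (hBB : Commute B B') (hAB' : Commute A B') (hBA' : Commute B A')
    (h : A' * A + B' * B = 1) : KoszulExact A B := by
  have h1 : ∀ x, A' (A x) + B' (B x) = x := fun x => by
    simpa using congr($h x)
  have e : ∀ {X Y : E →L[ℂ] E}, Commute X Y → ∀ x, X (Y x) = Y (X x) := fun hXY x => by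
    simpa using congr($(hXY.eq) x)
  refine ⟨fun x y hxy => ?_, fun ⟨x, y⟩ => ⟨fun hxy => ?_, ?_⟩, fun x => ?_⟩
  · simp only [koszul₀, prod_apply, Prod.mk.injEq] at hxy
    rw [← h1 x, ← h1 y, hxy.1, hxy.2]
  · simp only [koszul₁, sub_apply, comp_apply, coe_snd', coe_fst', sub_eq_zero] at hxy
    refine ⟨A' x + B' y, Prod.ext ?_ ?_⟩
    · simp only [koszul₀, prod_apply, map_add]
      rw [e hAA, e hAB', hxy, h1]
    · simp only [koszul₀, prod_apply, map_add]
      rw [e hBA', e hBB, ← hxy, h1]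
  · rintro ⟨w, hw⟩
    simp only [koszul₀, prod_apply, Prod.mk.injEq] at hw
    simp only [koszul₁, sub_apply, comp_apply, coe_snd', coe_fst', sub_eq_zero, ← hw.1, ← hw.2]
    exact e hAB w
  · refine ⟨(-B' x, A' x), ?_⟩
    simp only [koszul₁, sub_apply, comp_apply, coe_snd', coe_fst', map_neg, sub_neg_eq_add]
    rw [e hAA, e hBB, h1]

/-- Let `M ≥ |p|` on `Γ` imply `‖p(S, P)‖ ≤ M` for all polynomials `p`. By polynomial convexity,
the characters of the closed algebra generated by `S` and `P` correspond to points of `Γ`, so that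
its Gelfand theory gives the spectral inclusion and the invertibility of `q(S, P)` for each
polynomial `q` without zeros in `Γ`. -/
theorem taylorSpectrum_subset_Γ_and_isUnit [CompleteSpace E] {S P : E →L[ℂ] E} (hc : Commute S P)
    (hp : ∀ (p : MvPolynomial (Fin 2) ℂ) (M : ℝ), (∀ y ∈ Γ, ‖evalAt p y‖ ≤ M) →
      ‖polyEval p S P‖ ≤ M) :
    taylorSpectrum S P ⊆ Γ ∧
      ∀ q : MvPolynomial (Fin 2) ℂ, (∀ z ∈ Γ, evalAt q z ≠ 0) → IsUnit (polyEval q S P) := by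
  obtain ⟨C, _, _, _, φ, a, b, rfl, rfl, hφ⟩ := exists_commutative_banach_algebra hc
  have hχ : ∀ χ : WeakDual.characterSpace ℂ C, (χ a, χ b) ∈ Γ := by
    intro χ
    refine mem_Γ_of_forall_poly fun p M hM => ?_
    have h1 := evalAt_eq_map_aeval (WeakDual.CharacterSpace.equivAlgHom χ) a b p
    simp only [WeakDual.CharacterSpace.equivAlgHom_coe] at h1
    rw [← h1]
    have h2 := AlgHom.norm_apply_le_self_mul_norm_one χ (MvPolynomial.aeval ![a, b] p)
    have h3 : ‖(1 : C)‖ ≤ 1 := by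
      rw [← hφ, map_one]; exact norm_id_le
    have h4 := hp p M hM
    rw [polyEval_map, hφ] at h4
    nlinarith [norm_nonneg (MvPolynomial.aeval ![a, b] p)]
  constructor
  · intro z hz
    by_contra hzΓ
    refine hz ?_
    have hI : Ideal.span {a - algebraMap ℂ C z.1, b - algebraMap ℂ C z.2} = ⊤ := by
      by_contra hI
      obtain ⟨m, hm, hle⟩ := Ideal.exists_le_maximal _ hI
      have h1 := m.toCharacterSpace_apply_eq_zero_of_mem (hle (Ideal.subset_span (by simp)) :
        a - algebraMap ℂ C z.1 ∈ m)
      have h2 := m.toCharacterSpace_apply_eq_zero_of_mem (hle (Ideal.subset_span (by simp)) :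
        b - algebraMap ℂ C z.2 ∈ m)
      simp only [map_sub, AlgHomClass.commutes, sub_eq_zero, Algebra.algebraMap_self,
        RingHom.id_apply] at h1 h2
      have h3 := hχ m.toCharacterSpace
      rw [h1, h2] at h3
      exact hzΓ h3
    obtain ⟨u, v, huv⟩ := Ideal.mem_span_pair.1 (hI ▸ Submodule.mem_top : (1 : C) ∈ _)
    have hsub : ∀ (c : C) (w : ℂ), φ c - w • 1 = φ (c - algebraMap ℂ C w) := fun c w => by
      rw [map_sub, AlgHom.commutes, Algebra.algebraMap_eq_smul_one]
    rw [hsub, hsub]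
    have hcomm : ∀ x y : C, Commute (φ x) (φ y) := fun x y => (Commute.all x y).map φ
    refine koszulExact_of_mul_add_mul_eq_one (A' := φ u) (B' := φ v) (hcomm _ _) (hcomm _ _)
      (hcomm _ _) (hcomm _ _) (hcomm _ _) ?_
    rw [← map_mul, ← map_mul, ← map_add, huv, map_one]
  · intro q hq
    rw [polyEval_map]
    refine IsUnit.map φ ?_
    by_contra hu
    obtain ⟨χ, h0⟩ := WeakDual.CharacterSpace.exists_apply_eq_zero hu
    have h1 := evalAt_eq_map_aeval (WeakDual.CharacterSpace.equivAlgHom χ) a b q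
    simp only [WeakDual.CharacterSpace.equivAlgHom_coe] at h1
    exact hq _ (hχ χ) (h1 ▸ h0)

theorem nonempty_Γ : Γ.Nonempty := ⟨0, G₂_subset_Γ zero_mem_G₂⟩

/-- Von Neumann's inequality on `Γ` in terms of bounds instead of suprema. -/
theorem isGammaContraction_of_bounds [CompleteSpace E] {S P : E →L[ℂ] E} (hc : Commute S P)
    (hp : ∀ (p : MvPolynomial (Fin 2) ℂ) (M : ℝ), (∀ y ∈ Γ, ‖evalAt p y‖ ≤ M) →
      ‖polyEval p S P‖ ≤ M)
    (hpq : ∀ (p q : MvPolynomial (Fin 2) ℂ) (M : ℝ), (∀ y ∈ Γ, evalAt q y ≠ 0) →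
      (∀ y ∈ Γ, ‖evalAt p y / evalAt q y‖ ≤ M) → IsUnit (polyEval q S P) →
        ‖polyEval p S P * Ring.inverse (polyEval q S P)‖ ≤ M) :
    IsGammaContraction S P := by
  obtain ⟨h1, h2⟩ := taylorSpectrum_subset_Γ_and_isUnit hc hp
  refine ⟨hc, h1, fun p q hq => ⟨h2 q hq, hpq p q _ hq (fun y hy => ?_) (h2 q hq)⟩⟩
  refine le_csSup ?_ ⟨y, hy, rfl⟩
  refine (isCompact_Γ.image_of_continuousOn ?_).bddAbove
  exact ((continuous_evalAt p).continuousOn.div (continuous_evalAt q).continuousOn hq).norm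

theorem IsGammaContraction.norm_mul_inverse_le {S P : E →L[ℂ] E} (h : IsGammaContraction S P)
    {p q : MvPolynomial (Fin 2) ℂ} {M : ℝ} (hq : ∀ y ∈ Γ, evalAt q y ≠ 0)
    (hM : ∀ y ∈ Γ, ‖evalAt p y / evalAt q y‖ ≤ M) :
    ‖polyEval p S P * Ring.inverse (polyEval q S P)‖ ≤ M := by
  refine ((h.2.2 p q hq).2).trans (csSup_le (nonempty_Γ.image _) ?_)
  rintro _ ⟨y, hy, rfl⟩
  exact hM y hy

theorem IsGammaContraction.norm_polyEval_le {S P : E →L[ℂ] E} (h : IsGammaContraction S P)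
    {p : MvPolynomial (Fin 2) ℂ} {M : ℝ} (hM : ∀ y ∈ Γ, ‖evalAt p y‖ ≤ M) :
    ‖polyEval p S P‖ ≤ M := by
  have := h.norm_mul_inverse_le (p := p) (q := 1) (M := M) (by simp [evalAt])
    (by simpa [evalAt] using hM)
  simpa [polyEval_one] using this

/-- The restriction of a `Γ`-contraction to a joint invariant subspace, which is the image of the
isometry `J`, is a `Γ`-contraction. -/
theorem IsGammaContraction.restrict [CompleteSpace E] {E' : Type*} [NormedAddCommGroup E']
    [NormedSpace ℂ E'] {S P : E →L[ℂ] E} {T U : E' →L[ℂ] E'} (h : IsGammaContraction T U)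
    (J : E →ₗᵢ[ℂ] E') (hS : ∀ x, J (S x) = T (J x)) (hP : ∀ x, J (P x) = U (J x)) :
    IsGammaContraction S P := by
  have hc : Commute S P := by
    ext x
    apply J.injective
    rw [mul_apply_eq_comp, mul_apply_eq_comp, hS, hP, hP, hS]
    simpa using congr($(h.1.eq) (J x))
  have hJ : ∀ p x, J (polyEval p S P x) = polyEval p T U (J x) :=
    polyEval_intertwine (J := J.toLinearMap) hS hP
  refine isGammaContraction_of_bounds hc (fun p M hM => ?_) fun p q M hq hM hu => ?_
  · have hM0 : 0 ≤ M := (norm_nonneg _).trans (hM _ nonempty_Γ.some_mem)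
    refine opNorm_le_bound _ hM0 fun x => ?_
    rw [← J.norm_map, hJ, ← J.norm_map x]
    exact le_of_opNorm_le _ (h.norm_polyEval_le hM) _
  · have hM0 : 0 ≤ M := (norm_nonneg _).trans (hM _ nonempty_Γ.some_mem)
    refine opNorm_le_bound _ hM0 fun x => ?_
    set y := Ring.inverse (polyEval q S P) x with hy
    have hxy : x = polyEval q S P y := by
      rw [hy, ← mul_apply_eq_comp, Ring.mul_inverse_cancel _ hu, one_apply_eq_self]
    have h1 : J y = Ring.inverse (polyEval q T U) (J x) := by
      rw [hxy, hJ, ← mul_apply_eq_comp, Ring.inverse_mul_cancel _ (h.2.2 1 q hq).1, one_apply_eq_self]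
    rw [mul_apply_eq_comp, ← hy, ← J.norm_map, hJ, h1, ← mul_apply_eq_comp, ← J.norm_map x]
    exact le_of_opNorm_le _ (h.norm_mul_inverse_le hq hM) _

end Criteria

theorem IsGammaContraction.adjoint {H : Type*} [NormedAddCommGroup H] [InnerProductSpace ℂ H]
    [CompleteSpace H] {S P : H →L[ℂ] H} (h : IsGammaContraction S P) :
    IsGammaContraction (adjoint S) (adjoint P) := by
  have hc : Commute (ContinuousLinearMap.adjoint S) (ContinuousLinearMap.adjoint P) :=
    h.1.star_star
  have hadj : ∀ p, polyEval p (ContinuousLinearMap.adjoint S) (ContinuousLinearMap.adjoint P) =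
      star (polyEval (conjPoly p) S P) := fun p => by
    rw [star_eq_adjoint, adjoint_polyEval h.1, conjPoly_conjPoly]
  refine isGammaContraction_of_bounds hc (fun p M hM => ?_) fun p q M hq hM _ => ?_
  · rw [hadj, norm_star]
    refine h.norm_polyEval_le fun y hy => ?_
    rw [evalAt_conjPoly, Complex.norm_conj]
    exact hM _ (conj_mem_Γ hy)
  · have hq' : ∀ y ∈ Γ, evalAt (conjPoly q) y ≠ 0 := fun y hy => by
      rw [evalAt_conjPoly]
      simpa using hq _ (conj_mem_Γ hy)
    have hcom : Commute (polyEval (conjPoly p) S P) (Ring.inverse (polyEval (conjPoly q) S P)) := by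
      obtain ⟨u, hu⟩ := (h.2.2 1 _ hq').1
      rw [← hu, Ring.inverse_unit]
      exact Commute.units_inv_right (hu ▸ polyEval_commute h.1 _ _)
    rw [hadj, hadj, Ring.inverse_star, ← star_mul, norm_star, ← hcom.eq]
    refine h.norm_mul_inverse_le hq' fun y hy => ?_
    rw [evalAt_conjPoly, evalAt_conjPoly, ← map_div₀, Complex.norm_conj]
    exact hM _ (conj_mem_Γ hy)

/-! ### `Γ`-unitaries -/

/-- The C⋆-algebra generated by two commuting normal operators, as an abstract commutative
C⋆-algebra; its commutativity is Fuglede's theorem, and the last property is spectral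
permanence. -/
theorem exists_commutative_cstar_algebra {K : Type u} [NormedAddCommGroup K]
    [InnerProductSpace ℂ K] [CompleteSpace K] {T U : K →L[ℂ] K} (h : Commute T U)
    (hT : IsStarNormal T) (hU : IsStarNormal U) :
    ∃ (C : Type u) (_ : CommCStarAlgebra C) (φ : C →⋆ₐ[ℂ] (K →L[ℂ] K)) (a b : C),
      φ a = T ∧ φ b = U ∧ (∀ c, ‖φ c‖ = ‖c‖) ∧ ∀ c, IsUnit (φ c) → IsUnit c := by
  let B : StarSubalgebra ℂ (K →L[ℂ] K) := StarAlgebra.adjoin ℂ {T, U}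
  have hB : ∀ x y : B, x * y = y * x := by
    have h1 : ∀ x ∈ ({T, U} : Set (K →L[ℂ] K)), ∀ y ∈ ({T, U} : Set (K →L[ℂ] K)),
        x * y = y * x := by
      rintro x (rfl | rfl) y (rfl | rfl)
      exacts [rfl, h.eq, h.eq.symm, rfl]
    have h2 : ∀ x ∈ ({T, U} : Set (K →L[ℂ] K)), ∀ y ∈ ({T, U} : Set (K →L[ℂ] K)),
        x * star y = star y * x := by
      rintro x hx y hy
      have hy' : IsStarNormal y := by rcases hy with (rfl | rfl) <;> assumption
      exact hy'.commute_star_right (h1 x hx y hy)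
    exact fun x y => (StarAlgebra.isMulCommutative_adjoin ℂ h1 h2).is_comm.comm x y
  let C := B.topologicalClosure
  have hC : IsClosed (C : Set (K →L[ℂ] K)) := B.isClosed_topologicalClosure
  let _ : CommCStarAlgebra C :=
    { (StarSubalgebra.cstarAlgebra C : CStarAlgebra C) with
      mul_comm := (B.commRingTopologicalClosure hB).mul_comm }
  refine ⟨C, inferInstance, C.subtype,
    ⟨T, B.le_topologicalClosure (StarAlgebra.subset_adjoin ℂ _ (by simp))⟩,
    ⟨U, B.le_topologicalClosure (StarAlgebra.subset_adjoin ℂ _ (by simp))⟩, rfl, rfl,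
    fun _ => rfl, fun c hc => ?_⟩
  exact C.coe_isUnit.1 hc

/-- If the row `(A, -B)` is surjective, then `A A* + B B*` is invertible. -/
theorem isUnit_of_surjective_koszul₁ {K : Type*} [NormedAddCommGroup K] [InnerProductSpace ℂ K]
    [CompleteSpace K] {A B : K →L[ℂ] K} (h : Function.Surjective (koszul₁ A B)) :
    IsUnit (A * star A + B * star B) := by
  obtain ⟨c, hc, hpre⟩ := (koszul₁ A B).exists_preimage_norm_le h
  have hbound : ∀ y, ‖y‖ ≤ c * (‖star A y‖ + ‖star B y‖) := by
    intro y
    rcases eq_or_ne y 0 with rfl | hy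
    · simp
    obtain ⟨⟨x₁, x₂⟩, hx, hxn⟩ := hpre y
    have hx' : A x₂ - B x₁ = y := by simpa [koszul₁] using hx
    have h1 : ‖x₁‖ ≤ c * ‖y‖ := (norm_fst_le (x₁, x₂)).trans hxn
    have h2 : ‖x₂‖ ≤ c * ‖y‖ := (norm_snd_le (x₁, x₂)).trans hxn
    have h3 : ‖y‖ * ‖y‖ ≤ ‖star A y‖ * ‖x₂‖ + ‖star B y‖ * ‖x₁‖ := by
      calc ‖y‖ * ‖y‖ = ‖inner ℂ y y‖ := by
            simp [inner_self_eq_norm_sq_to_K, sq]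
        _ = ‖inner ℂ (star A y) x₂ - inner ℂ (star B y) x₁‖ := by
            rw [star_eq_adjoint, star_eq_adjoint, adjoint_inner_left, adjoint_inner_left,
              ← inner_sub_right, hx']
        _ ≤ _ := (norm_sub_le _ _).trans
            (add_le_add (norm_inner_le_norm _ _) (norm_inner_le_norm _ _))
    have h4 : ‖y‖ * ‖y‖ ≤ (c * (‖star A y‖ + ‖star B y‖)) * ‖y‖ := by
      nlinarith [mul_le_mul_of_nonneg_left h1 (norm_nonneg (star B y)),
        mul_le_mul_of_nonneg_left h2 (norm_nonneg (star A y))]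
    exact le_of_mul_le_mul_right h4 (norm_pos_iff.2 hy)
  have hd : (0 : ℝ) < (2 * c ^ 2)⁻¹ := by positivity
  have hle : algebraMap ℝ (K →L[ℂ] K) (2 * c ^ 2)⁻¹ ≤ A * star A + B * star B := by
    rw [ContinuousLinearMap.le_def, isPositive_iff_complex]
    intro y
    have e : inner ℂ ((A * star A + B * star B - algebraMap ℝ (K →L[ℂ] K) (2 * c ^ 2)⁻¹) y) y =
        ((‖star A y‖ ^ 2 + ‖star B y‖ ^ 2 - (2 * c ^ 2)⁻¹ * ‖y‖ ^ 2 : ℝ) : ℂ) := by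
      have hX : ∀ X : K →L[ℂ] K, inner ℂ ((X * star X) y) y = ((‖star X y‖ ^ 2 : ℝ) : ℂ) := by
        intro X
        rw [mul_apply_eq_comp, star_eq_adjoint, ← adjoint_inner_right, inner_self_eq_norm_sq_to_K]
        simp
      have hr : inner ℂ (((2 * c ^ 2)⁻¹ : ℝ) • y) y = (((2 * c ^ 2)⁻¹ * ‖y‖ ^ 2 : ℝ) : ℂ) := by
        rw [← Complex.coe_smul, inner_smul_left, Complex.conj_ofReal, inner_self_eq_norm_sq_to_K]
        simp
      rw [Algebra.algebraMap_eq_smul_one, sub_apply, add_apply, smul_apply, one_apply_eq_self,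
        inner_sub_left, inner_add_left, hX, hX, hr]
      push_cast
      ring
    rw [e]
    refine ⟨congrArg _ (Complex.ofReal_re _), ?_⟩
    simp only [RCLike.re_to_complex, Complex.ofReal_re]
    have h5 : ‖y‖ ^ 2 ≤ 2 * c ^ 2 * (‖star A y‖ ^ 2 + ‖star B y‖ ^ 2) := by
      calc ‖y‖ ^ 2 ≤ (c * (‖star A y‖ + ‖star B y‖)) ^ 2 :=
            pow_le_pow_left₀ (norm_nonneg _) (hbound y) 2
        _ = c ^ 2 * (‖star A y‖ + ‖star B y‖) ^ 2 := by ring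
        _ ≤ c ^ 2 * (2 * (‖star A y‖ ^ 2 + ‖star B y‖ ^ 2)) := by
            gcongr
            nlinarith [sq_nonneg (‖star A y‖ - ‖star B y‖)]
        _ = _ := by ring
    rw [sub_nonneg, inv_mul_le_iff₀ (by positivity)]
    exact h5
  exact CStarAlgebra.isUnit_of_le _ hle
    (IsUnit.isStrictlyPositive ((IsUnit.mk0 _ hd.ne').map (algebraMap ℝ (K →L[ℂ] K)))
      (algebraMap_nonneg _ hd.le))

variable {K : Type u} [NormedAddCommGroup K] [InnerProductSpace ℂ K] [CompleteSpace K]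

/-- The Gelfand picture of a `Γ`-unitary: a pair in a commutative C⋆-algebra of operators on which
the characters take values in `bΓ`. -/
theorem IsGammaUnitary.exists_gelfand {T U : K →L[ℂ] K} (h : IsGammaUnitary T U) :
    ∃ (C : Type u) (_ : CommCStarAlgebra C) (φ : C →⋆ₐ[ℂ] (K →L[ℂ] K)) (a b : C),
      φ a = T ∧ φ b = U ∧ (∀ c, ‖φ c‖ = ‖c‖) ∧
        ∀ χ : WeakDual.characterSpace ℂ C, (χ a, χ b) ∈ bΓ := by
  obtain ⟨hc, hT, hU, hsp⟩ := h
  obtain ⟨C, _, φ, a, b, rfl, rfl, hφ, hunit⟩ := exists_commutative_cstar_algebra hc hT hU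
  refine ⟨C, inferInstance, φ, a, b, rfl, rfl, hφ, fun χ => hsp fun hK => ?_⟩
  have hsub : ∀ (c : C) (w : ℂ), φ c - w • 1 = φ (c - algebraMap ℂ C w) := fun c w => by
    rw [map_sub, AlgHomClass.commutes, Algebra.algebraMap_eq_smul_one]
  have h1 := isUnit_of_surjective_koszul₁ hK.2.2
  simp only [hsub, ← map_star, ← map_mul, ← map_add] at h1
  have h2 := (hunit _ h1).map χ
  simp only [map_add, map_mul, map_sub, AlgHomClass.commutes, Algebra.algebraMap_self,
    RingHom.id_apply, sub_self, zero_mul, add_zero] at h2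
  simp at h2

theorem norm_le_of_forall_character {C : Type*} [CommCStarAlgebra C] {c : C} {M : ℝ} (hM : 0 ≤ M)
    (h : ∀ χ : WeakDual.characterSpace ℂ C, ‖χ c‖ ≤ M) : ‖c‖ ≤ M := by
  have := (gelfandTransform_isometry C).norm_map_of_map_zero (map_zero _) c
  rw [← this, ContinuousMap.norm_le _ hM]
  exact h

theorem IsGammaUnitary.star_mul_self {T U : K →L[ℂ] K} (h : IsGammaUnitary T U) :
    star U * U = 1 := by
  obtain ⟨C, _, φ, a, b, rfl, rfl, hφ, hχ⟩ := h.exists_gelfand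
  rw [← map_star, ← map_mul, ← map_one φ]
  congr 1
  refine (gelfandTransform_isometry C).injective (ContinuousMap.ext fun χ => ?_)
  change χ (star b * b) = χ 1
  rw [map_mul, map_one, map_star, Complex.star_def, Complex.conj_mul',
    norm_snd_eq_one_of_mem_bΓ (hχ χ)]
  simp

theorem IsGammaUnitary.eq_star_mul {T U : K →L[ℂ] K} (h : IsGammaUnitary T U) :
    T = star T * U := by
  obtain ⟨C, _, φ, a, b, rfl, rfl, hφ, hχ⟩ := h.exists_gelfand
  rw [← map_star, ← map_mul]
  congr 1
  refine (gelfandTransform_isometry C).injective (ContinuousMap.ext fun χ => ?_)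
  change χ a = χ (star a * b)
  rw [map_mul, map_star]
  exact fst_eq_of_mem_bΓ (hχ χ)

theorem IsGammaUnitary.isGammaContraction {T U : K →L[ℂ] K} (h : IsGammaUnitary T U) :
    IsGammaContraction T U := by
  obtain ⟨C, _, φ, a, b, rfl, rfl, hφ, hχ⟩ := h.exists_gelfand
  have hχp : ∀ (χ : WeakDual.characterSpace ℂ C) p,
      χ (MvPolynomial.aeval ![a, b] p) = evalAt p (χ a, χ b) := fun χ p => by
    simpa only [WeakDual.CharacterSpace.equivAlgHom_coe] using
      evalAt_eq_map_aeval (WeakDual.CharacterSpace.equivAlgHom χ) a b p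
  have hpoly : ∀ p, polyEval p (φ a) (φ b) = φ (MvPolynomial.aeval ![a, b] p) :=
    polyEval_map φ.toAlgHom a b
  refine isGammaContraction_of_bounds h.1 (fun p M hM => ?_) fun p q M hq hM _ => ?_
  · rw [hpoly, hφ]
    refine norm_le_of_forall_character
      ((norm_nonneg _).trans (hM _ nonempty_Γ.some_mem)) fun χ => ?_
    rw [hχp]
    exact hM _ (bΓ_subset_Γ (hχ χ))
  · have hu : IsUnit (MvPolynomial.aeval ![a, b] q) := by
      by_contra hu
      obtain ⟨χ, h0⟩ := WeakDual.CharacterSpace.exists_apply_eq_zero hu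
      rw [hχp] at h0
      exact hq _ (bΓ_subset_Γ (hχ χ)) h0
    obtain ⟨v, hv⟩ := hu
    have hinv : Ring.inverse (φ (v : C)) = φ (↑v⁻¹ : C) := by
      simpa using Ring.inverse_unit (Units.map (φ : C →* (K →L[ℂ] K)) v)
    rw [hpoly, hpoly, ← hv, hinv, ← map_mul, hφ]
    refine norm_le_of_forall_character
      ((norm_nonneg _).trans (hM _ nonempty_Γ.some_mem)) fun χ => ?_
    have h1 : χ (↑v⁻¹ : C) = (evalAt q (χ a, χ b))⁻¹ := by
      rw [← hχp, ← hv]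
      refine eq_inv_of_mul_eq_one_left ?_
      rw [← map_mul, Units.inv_mul, map_one]
    rw [map_mul, hχp, h1, ← div_eq_mul_inv]
    exact hM _ (bΓ_subset_Γ (hχ χ))

/-! ### `Γ`-isometries -/

section Isometry

variable {H : Type u} [NormedAddCommGroup H] [InnerProductSpace ℂ H] [CompleteSpace H]
  {S P : H →L[ℂ] H}

theorem IsGammaIsometry.isGammaContraction (h : IsGammaIsometry S P) : IsGammaContraction S P := by
  obtain ⟨K, _, _, _, T, U, J, hTU, hS, hP⟩ := h
  exact hTU.isGammaContraction.restrict J hS hP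

theorem IsGammaIsometry.star_mul_self (h : IsGammaIsometry S P) : star P * P = 1 := by
  obtain ⟨K, _, _, _, T, U, J, hTU, hS, hP⟩ := h
  refine ContinuousLinearMap.ext fun x => ext_inner_right ℂ fun y => ?_
  rw [mul_apply_eq_comp, star_eq_adjoint, adjoint_inner_left, one_apply_eq_self,
    ← J.inner_map_map, hP, hP, ← adjoint_inner_left, ← star_eq_adjoint, ← mul_apply_eq_comp,
    hTU.star_mul_self, one_apply_eq_self, J.inner_map_map]

theorem IsGammaIsometry.eq_star_mul (h : IsGammaIsometry S P) : S = star S * P := by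
  obtain ⟨K, _, _, _, T, U, J, hTU, hS, hP⟩ := h
  refine ContinuousLinearMap.ext fun x => ext_inner_right ℂ fun y => ?_
  rw [mul_apply_eq_comp, star_eq_adjoint, adjoint_inner_left, ← J.inner_map_map,
    ← J.inner_map_map, hP, hS, hS, ← adjoint_inner_left, ← star_eq_adjoint, ← mul_apply_eq_comp,
    ← hTU.eq_star_mul]

end Isometry

theorem IsGammaContraction.norm_fst_le {E : Type*} [NormedAddCommGroup E] [NormedSpace ℂ E]
    {S P : E →L[ℂ] E} (h : IsGammaContraction S P) : ‖S‖ ≤ 2 := by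
  rw [← polyEval_X_zero S P]
  refine h.norm_polyEval_le fun y hy => ?_
  simpa [evalAt] using norm_fst_le_two_of_mem_Γ hy

/-! ### Numerical range and eigenvalues in finite dimensions -/

section FiniteDimensional

variable {V : Type*} [NormedAddCommGroup V] [InnerProductSpace ℂ V]

theorem mem_spectrum_iff_exists_eigenvector [FiniteDimensional ℂ V] {F : V →L[ℂ] V} {c : ℂ} :
    c ∈ spectrum ℂ F ↔ ∃ v, v ≠ 0 ∧ F v = c • v := by
  have h : F = Module.End.toContinuousLinearMap V (F : V →ₗ[ℂ] V) := rfl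
  rw [h, AlgEquiv.spectrum_eq, ← Module.End.hasEigenvalue_iff_mem_spectrum]
  constructor
  · intro hc
    obtain ⟨v, hv⟩ := hc.exists_hasEigenvector
    exact ⟨v, hv.2, hv.apply_eq_smul⟩
  · rintro ⟨v, hv, hv'⟩
    exact Module.End.hasEigenvalue_of_hasEigenvector
      (Module.End.hasEigenvector_iff.2 ⟨Module.End.mem_eigenspace_iff.2 hv', hv⟩)

theorem norm_lt_one_of_mem_spectrum {F : V →L[ℂ] V} (h : spectralRadius ℂ F < 1) {c : ℂ}
    (hc : c ∈ spectrum ℂ F) : ‖c‖ < 1 := by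
  have h1 : (‖c‖₊ : ENNReal) < 1 := (le_iSup₂ (f := fun k (_ : k ∈ spectrum ℂ F) =>
    (‖k‖₊ : ENNReal)) c hc).trans_lt h
  exact_mod_cast h1

theorem spectralRadius_lt_one_of_forall [CompleteSpace V] {F : V →L[ℂ] V}
    (h : ∀ c ∈ spectrum ℂ F, ‖c‖ < 1) : spectralRadius ℂ F < 1 := by
  rcases (spectrum ℂ F).eq_empty_or_nonempty with h0 | h0
  · simp [spectralRadius, h0]
  · exact_mod_cast spectrum.spectralRadius_lt_of_forall_lt_of_nonempty h0 (r := 1)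
      fun c hc => by exact_mod_cast h c hc

/-- A vector at which the quadratic form of a positive operator vanishes is in its kernel. -/
theorem apply_eq_zero_of_inner_eq_zero [CompleteSpace V] {B : V →L[ℂ] V} (hB : 0 ≤ B) {v : V}
    (h : inner ℂ (B v) v = 0) : B v = 0 := by
  have h1 := CFC.sqrt_mul_sqrt_self B hB
  have h2 : adjoint (CFC.sqrt B) = CFC.sqrt B :=
    (IsSelfAdjoint.of_nonneg (CFC.sqrt_nonneg B)).star_eq
  have h3 : CFC.sqrt B v = 0 := by
    rw [← inner_self_eq_zero (𝕜 := ℂ)]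
    nth_rewrite 2 [← h2]
    rw [adjoint_inner_right, ← mul_apply_eq_comp, h1, h]
  rw [← h1, mul_apply_eq_comp, h3, map_zero]

/-- If the numerical radius of `F` is at most one, a pair `(z, w)` with `|z| = 1 > |w|` for which
`F* + zw F - (z + w)` is singular comes from an eigenvector of `F` to the eigenvalue `z⁻¹`: the
quadratic form of `F` takes on this vector a unimodular value, which is extremal. -/
theorem apply_eq_smul_of_numericalRadius_le_one [CompleteSpace V] {F : V →L[ℂ] V}
    (hF : ∀ c : ℂ, ‖c‖ = 1 → ∀ v, (c * inner ℂ v (F v)).re ≤ ‖v‖ ^ 2)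
    {z w : ℂ} (hz : ‖z‖ = 1) (hw : ‖w‖ < 1) {v : V}
    (hv : adjoint F v + (z * w) • F v = (z + w) • v) : F v = conj z • v := by
  have hzz : z * conj z = 1 := by rw [Complex.mul_conj', hz]; simp
  set m : ℂ := inner ℂ v (F v) with hm
  set N : ℝ := ‖v‖ ^ 2 with hN
  have hvv : inner ℂ v v = (N : ℂ) := by rw [inner_self_eq_norm_sq_to_K]; simp [hN]
  have hm' : inner ℂ v (adjoint F v) = conj m := by
    rw [adjoint_inner_right, hm, inner_conj_symm]
  have h1 : conj m + z * w * m = (z + w) * N := by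
    rw [← hm', ← hvv, hm, ← inner_smul_right, ← inner_smul_right, ← inner_add_right, hv]
  -- `|w| < 1` forces `⟨v, F v⟩ = conj z * ‖v‖²`
  have h2 : conj (m - conj z * N) = -(w * z) * (m - conj z * N) := by
    simp only [map_sub, map_mul, Complex.conj_conj, Complex.conj_ofReal]
    linear_combination h1 - w * N * hzz
  have h3 : m - conj z * N = 0 := by
    have h4 := congrArg norm h2
    rw [Complex.norm_conj, norm_mul, norm_neg, norm_mul, hz, mul_one] at h4
    by_contra h0
    have := norm_pos_iff.2 h0
    nlinarith
  have hmN : z * m = N := by linear_combination z * h3 + N * hzz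
  -- the operator `2 - 2 Re (z F)` is positive and its quadratic form vanishes at `v`
  let B : V →L[ℂ] V := (2 : ℂ) • 1 - z • F - conj z • adjoint F
  have hBinner : ∀ u, inner ℂ (B u) u =
      ((2 * (‖u‖ ^ 2 - (z * inner ℂ u (F u)).re) : ℝ) : ℂ) := by
    intro u
    have hre := Complex.add_conj (z * inner ℂ u (F u))
    simp only [B, sub_apply, smul_apply, one_apply_eq_self, inner_sub_left, inner_smul_left,
      adjoint_inner_left, inner_self_eq_norm_sq_to_K]
    rw [← inner_conj_symm (F u) u]
    rw [map_mul] at hre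
    push_cast at hre ⊢
    simp only [Complex.conj_conj, map_ofNat, Complex.coe_algebraMap]
    linear_combination -hre
  have hB : 0 ≤ B := by
    rw [ContinuousLinearMap.nonneg_iff_isPositive, isPositive_iff_complex]
    intro u
    rw [hBinner]
    refine ⟨congrArg _ (Complex.ofReal_re _), ?_⟩
    simp only [RCLike.re_to_complex, Complex.ofReal_re]
    linarith [hF z hz u]
  have hBv : B v = 0 := apply_eq_zero_of_inner_eq_zero hB (by
    rw [hBinner, ← hm, hmN, Complex.ofReal_re, ← hN]; simp)
  have hBv' : (2 : ℂ) • v - z • F v - conj z • adjoint F v = 0 := hBv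
  have hzw : z - w ≠ 0 := sub_ne_zero.2 fun h => by rw [h] at hz; linarith
  -- eliminate `F* v` from the two linear relations
  have h5 : (z * (z - w)) • (F v - conj z • v) = 0 := by
    have e1 : adjoint F v = (z + w) • v - (z * w) • F v := by rw [← hv]; abel
    rw [e1] at hBv'
    have e2 : (z * (z - w)) • (F v - conj z • v) = (-z) • ((2 : ℂ) • v - z • F v -
        conj z • ((z + w) • v - (z * w) • F v)) := by
      match_scalars
      · linear_combination (z * w) * hzz
      · linear_combination (-2 * z) * hzz
    rw [e2, hBv', smul_zero]
  have hz0 : z ≠ 0 := fun h => by simp [h] at hz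
  exact sub_eq_zero.1 ((smul_eq_zero.1 h5).resolve_left (mul_ne_zero hz0 hzw))

theorem evalAt_detPoly_eq_zero_iff [CompleteSpace V] [FiniteDimensional ℂ V] (F : V →L[ℂ] V)
    (x : ℂ × ℂ) :
    evalAt (detPoly F) x = 0 ↔ ∃ v, v ≠ 0 ∧ adjoint F v + x.2 • F v = x.1 • v := by
  rw [evalAt_detPoly, LinearMap.det_eq_zero_iff_ker_ne_bot, Submodule.ne_bot_iff]
  refine exists_congr fun v => ?_
  rw [and_comm, and_congr_right_iff]
  intro _
  rw [← sub_eq_zero (b := x.1 • v)]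
  simp

/-- A zero of the polynomial in `𝔾₂` is `(c, 0)` for an eigenvalue `c` of `F*`; this is where the
space has to be nonzero. -/
theorem isDistinguishedPoly_detPoly [CompleteSpace V] [FiniteDimensional ℂ V] [Nontrivial V]
    {F : V →L[ℂ] V} (hF : ∀ c : ℂ, ‖c‖ = 1 → ∀ v, (c * inner ℂ v (F v)).re ≤ ‖v‖ ^ 2)
    (hr : spectralRadius ℂ F < 1) : IsDistinguishedPoly (detPoly F) := by
  rw [isDistinguishedPoly_iff]
  constructor
  · obtain ⟨c, hc⟩ := spectrum.nonempty (star F)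
    have hc1 : ‖c‖ < 1 := by
      have : star c ∈ spectrum ℂ F := by
        rwa [← Set.mem_star, ← spectrum.map_star]
      simpa using norm_lt_one_of_mem_spectrum hr this
    obtain ⟨v, hv, hv'⟩ := mem_spectrum_iff_exists_eigenvector.1 hc
    refine ⟨(c, 0), ⟨(c, 0), by simpa using hc1, (mk_zero_eq_symm c).symm⟩, ?_⟩
    exact (evalAt_detPoly_eq_zero_iff F _).2 ⟨v, hv, by simpa [star_eq_adjoint] using hv'⟩
  · intro x hx h
    obtain ⟨z, w, hz, hw, rfl⟩ := exists_symm_eq_of_mem_frontier hx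
    rcases hw.eq_or_lt with hw | hw
    · exact ⟨(z, w), ⟨hz, hw⟩, rfl⟩
    obtain ⟨v, hv, hv'⟩ := (evalAt_detPoly_eq_zero_iff F _).1 h
    have h1 := apply_eq_smul_of_numericalRadius_le_one hF hz hw hv'
    have h2 := norm_lt_one_of_mem_spectrum hr (mem_spectrum_iff_exists_eigenvector.2 ⟨v, hv, h1⟩)
    rw [Complex.norm_conj, hz] at h2
    exact (lt_irrefl _ h2).elim

/-- A `Γ`-distinguished polynomial annihilating `(F, 0)` excludes unimodular eigenvalues `c` of
`F`, because it does not vanish at `(c, 0)`. -/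
theorem spectralRadius_lt_one_of_isGammaDistinguished [FiniteDimensional ℂ V] [CompleteSpace V]
    {F : V →L[ℂ] V} (h : IsGammaDistinguished F 0) : spectralRadius ℂ F < 1 := by
  obtain ⟨hG, p, hp, hp0⟩ := h
  refine spectralRadius_lt_one_of_forall fun c hc => ?_
  obtain ⟨v, hv, hcv⟩ := mem_spectrum_iff_exists_eigenvector.1 hc
  have hmem : (c, (0 : ℂ)) ∈ Γ := by
    refine hG.2.1 fun hK => hv (hK.1 ?_)
    simp [koszul₀, hcv]
  rw [mk_zero_eq_symm, symm_mem_Γ] at hmem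
  refine hmem.1.lt_of_ne fun h1 => hp.evalAt_mk_zero_ne_zero h1 ?_
  have h2 := polyEval_zero_apply_eigenvector hcv p
  rw [hp0, zero_apply] at h2
  exact (smul_eq_zero.1 h2.symm).resolve_right hv

end FiniteDimensional

/-! ### The defect space of the adjoint of a pure isometry -/

section Defect

variable {H : Type u} [NormedAddCommGroup H] [InnerProductSpace ℂ H] [CompleteSpace H]
  {S P : H →L[ℂ] H}

/-- For an isometry `P` the defect operator of `P*` is the projection `1 - P P*`. -/
theorem defectOp_adjoint (hP : star P * P = 1) : defectOp (adjoint P) = 1 - P * star P := by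
  have hidem : (1 - P * star P) * (1 - P * star P) = 1 - P * star P := by
    have : P * star P * (P * star P) = P * star P := by
      rw [mul_assoc, ← mul_assoc (star P), hP, one_mul]
    rw [mul_sub, sub_mul, sub_mul, this]
    simp
  have hself : star (1 - P * star P) = 1 - P * star P := by simp
  rw [defectOp, adjoint_adjoint, ← star_eq_adjoint]
  refine CFC.sqrt_unique hidem ?_
  have := star_mul_self_nonneg (1 - P * star P)
  rwa [hself, hidem] at this

theorem mem_defectSpace_adjoint_iff (hP : star P * P = 1) {v : H} :
    v ∈ defectSpace (adjoint P) ↔ star P v = 0 := by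
  constructor
  · intro hv
    have hle : defectSpace (adjoint P) ≤ LinearMap.ker ((star P : H →L[ℂ] H) : H →ₗ[ℂ] H) := by
      refine Submodule.topologicalClosure_minimal _ ?_ (star P).isClosed_ker
      rintro _ ⟨x, rfl⟩
      have h0 : star P * (1 - P * star P) = 0 := by
        rw [mul_sub, ← mul_assoc, hP]; simp
      rw [LinearMap.mem_ker, defectOp_adjoint hP]
      simpa using congr($h0 x)
    exact LinearMap.mem_ker.1 (hle hv)
  · intro hv
    refine Submodule.le_topologicalClosure _ ⟨v, ?_⟩
    rw [defectOp_adjoint hP]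
    simp [hv]

/-- The projection onto the defect space fixes its vectors. -/
theorem defectOp_adjoint_apply (hP : star P * P = 1) {v : H}
    (hv : v ∈ defectSpace (adjoint P)) : defectOp (adjoint P) v = v := by
  rw [defectOp_adjoint hP]
  simp [(mem_defectSpace_adjoint_iff hP).1 hv]

/-- The fundamental operator of `(S*, P*)` is the restriction of `S*` to the kernel of `P*`. -/
theorem IsFundamentalOperator.coe_apply (hP : star P * P = 1)
    {F : defectSpace (adjoint P) →L[ℂ] defectSpace (adjoint P)}
    (hF : IsFundamentalOperator (adjoint S) (adjoint P) F) (v : defectSpace (adjoint P)) :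
    (F v : H) = adjoint S v := by
  have hv := (mem_defectSpace_adjoint_iff hP).1 v.2
  rw [star_eq_adjoint] at hv
  have hto : defectOpTo (adjoint P) (v : H) = v :=
    Subtype.ext (defectOp_adjoint_apply hP v.2)
  have h := congr($hF (v : H))
  simp only [sub_apply, mul_apply_eq_comp, comp_apply, hv, map_zero, sub_zero, hto,
    Submodule.subtypeL_apply] at h
  rw [h, defectOp_adjoint_apply hP (F v).2]

/-- A closed form of `S` on the kernel of `P*`: its components in the decomposition
`H = P H ⊕ ker P*` are given by `F` and `F*`. -/
theorem apply_coe_defectSpace (hP : star P * P = 1) (hS : S = star S * P)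
    [CompleteSpace (defectSpace (adjoint P))]
    {F : defectSpace (adjoint P) →L[ℂ] defectSpace (adjoint P)}
    (hF : ∀ v, (F v : H) = adjoint S v) (v : defectSpace (adjoint P)) :
    S v = P (F v) + adjoint F v := by
  have hS' : star P * S = star S := by
    conv_rhs => rw [hS]
    rw [star_mul, star_star]
  have h1 : star P (S v) = F v := by
    rw [← mul_apply_eq_comp, hS', hF, star_eq_adjoint]
  let w : defectSpace (adjoint P) := ⟨S v - P (F v), by
    rw [mem_defectSpace_adjoint_iff hP, map_sub, h1, ← mul_apply_eq_comp, hP, one_apply_eq_self,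
      sub_self]⟩
  have hw : w = adjoint F v := by
    refine ext_inner_right ℂ fun u => ?_
    have hu := (mem_defectSpace_adjoint_iff hP).1 u.2
    rw [star_eq_adjoint] at hu
    rw [adjoint_inner_left, Submodule.coe_inner, Submodule.coe_inner, hF, adjoint_inner_right]
    simp only [w]
    rw [inner_sub_left, ← adjoint_inner_right P, hu, inner_zero_right, sub_zero]
  rw [← hw]
  simp [w]

/-- If `P` is a pure isometry, an operator commuting with `P` is determined by its values on
`ker P*`: since `x = P P* x + (1 - P P*) x`, one has `R x = Pⁿ R P*ⁿ x`. -/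
theorem eq_zero_of_commute_of_isPure (hP : star P * P = 1) (hpure : IsPure P) {R : H →L[ℂ] H}
    (hR : Commute R P) (h0 : ∀ v ∈ defectSpace (adjoint P), R v = 0) : R = 0 := by
  have hstep : ∀ y, R y = P (R (adjoint P y)) := by
    intro y
    have hmem : y - P (adjoint P y) ∈ defectSpace (adjoint P) := by
      rw [mem_defectSpace_adjoint_iff hP, map_sub, ← star_eq_adjoint, ← mul_apply_eq_comp (star P),
        hP, one_apply_eq_self, sub_self]
    have h1 := h0 _ hmem
    rw [map_sub, sub_eq_zero] at h1
    calc R y = (R * P) (adjoint P y) := h1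
      _ = (P * R) (adjoint P y) := by rw [hR.eq]
      _ = P (R (adjoint P y)) := rfl
  have hiso : ∀ y, ‖P y‖ = ‖y‖ := fun y => by
    rw [(norm_map_iff_adjoint_comp_self P).2 hP]
  have hnorm : ∀ n x, ‖R x‖ = ‖R ((adjoint P ^ n) x)‖ := by
    intro n
    induction n with
    | zero => simp
    | succ n ih =>
      intro x
      rw [ih, hstep ((adjoint P ^ n) x), hiso, pow_succ', mul_apply_eq_comp]
  ext x
  have hlim : Tendsto (fun n : ℕ => ‖R ((adjoint P ^ n) x)‖) atTop (𝓝 0) := by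
    simpa using ((R.continuous.tendsto 0).comp (hpure x)).norm
  simp only [← hnorm _ x] at hlim
  simpa using tendsto_nhds_unique tendsto_const_nhds hlim

/-! ### The determinant annihilates the pair -/

/-- The Cayley–Hamilton argument: the relations `S v = P F v + F* v`, `v ∈ ker P*`, say that the
polynomial matrix `F* + z₂ F - z₁` annihilates a basis of `ker P*`, and one multiplies by its
adjugate. -/
theorem polyEval_detPoly_apply_eq_zero (hc : Commute S P)
    [FiniteDimensional ℂ (defectSpace (adjoint P))]
    {F : defectSpace (adjoint P) →L[ℂ] defectSpace (adjoint P)}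
    (hS : ∀ v : defectSpace (adjoint P), S v = P (F v) + adjoint F v)
    {v : H} (hv : v ∈ defectSpace (adjoint P)) : polyEval (detPoly F) S P v = 0 := by
  obtain ⟨C, _, _, _, φ, a, b, ha, hb, -⟩ := exists_commutative_banach_algebra hc
  let ψ : MvPolynomial (Fin 2) ℂ →ₐ[ℂ] (H →L[ℂ] H) := φ.comp (MvPolynomial.aeval ![a, b])
  have hψ : ∀ p, polyEval p S P = ψ p := fun p => by
    rw [← ha, ← hb, polyEval_map]; rfl
  have hψ0 : ψ (MvPolynomial.X 0) = S := by simp [ψ, ha]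
  have hψ1 : ψ (MvPolynomial.X 1) = P := by simp [ψ, hb]
  have hψC : ∀ c x, ψ (MvPolynomial.C c) x = c • x := fun c x => by
    rw [← MvPolynomial.algebraMap_eq, AlgHom.commutes, Algebra.algebraMap_eq_smul_one]; simp
  let e := Module.finBasis ℂ (defectSpace (adjoint P))
  let M := (matrixOf (adjoint F)).map MvPolynomial.C
      + (MvPolynomial.X 1 : MvPolynomial (Fin 2) ℂ) • (matrixOf F).map MvPolynomial.C
      - Matrix.scalar _ (MvPolynomial.X 0 : MvPolynomial (Fin 2) ℂ)
  have hcol : ∀ (G : defectSpace (adjoint P) →L[ℂ] defectSpace (adjoint P)) j,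
      ∑ i, matrixOf G i j • (e i : H) = G (e j) := by
    intro G j
    have h := congrArg (Submodule.subtype _) (e.sum_repr (G (e j)))
    rw [map_sum] at h
    simp only [matrixOf, LinearMap.toMatrix_apply]
    exact h
  have hM : ∀ j, ∑ i, ψ (M i j) (e i : H) = 0 := by
    intro j
    have hij : ∀ i, ψ (M i j) (e i : H) = matrixOf (adjoint F) i j • (e i : H) +
        P (matrixOf F i j • (e i : H)) - if i = j then S (e i) else 0 := by
      intro i
      simp only [M, Matrix.sub_apply, Matrix.add_apply, Matrix.map_apply, Matrix.smul_apply,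
        smul_eq_mul, Matrix.scalar_apply, Matrix.diagonal_apply, map_sub, map_add, map_mul,
        hψ1, sub_apply, add_apply, mul_apply_eq_comp, hψC]
      split_ifs <;> simp [hψ0]
    simp only [hij, Finset.sum_sub_distrib, Finset.sum_add_distrib, ← map_sum, hcol,
      Finset.sum_ite_eq', Finset.mem_univ, if_true, hS]
    abel
  have hdet : ∀ k, ψ (detPoly F) (e k : H) = 0 := by
    intro k
    have h1 : ∀ i, ∑ j, ψ (M.adjugate j k) (ψ (M i j) (e i : H)) =
        if i = k then ψ (detPoly F) (e i : H) else 0 := by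
      intro i
      have h2 := congr($(M.mul_adjugate) i k)
      rw [Matrix.mul_apply] at h2
      calc _ = ψ (∑ j, M i j * M.adjugate j k) (e i : H) := by
            rw [map_sum, sum_apply]
            refine Finset.sum_congr rfl fun j _ => ?_
            rw [mul_comm, map_mul, mul_apply_eq_comp]
        _ = _ := by
            rw [h2, Matrix.smul_apply, Matrix.one_apply, smul_eq_mul]
            split_ifs
            · rw [mul_one]; rfl
            · simp
    calc ψ (detPoly F) (e k : H) = ∑ i, ∑ j, ψ (M.adjugate j k) (ψ (M i j) (e i : H)) := by
          simp [h1]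
      _ = ∑ j, ψ (M.adjugate j k) (∑ i, ψ (M i j) (e i : H)) := by
          rw [Finset.sum_comm]
          simp only [map_sum]
      _ = 0 := by simp [hM]
  rw [hψ]
  have hsum : v = ∑ i, e.repr ⟨v, hv⟩ i • (e i : H) := by
    have h := congrArg (Submodule.subtype _) (e.sum_repr ⟨v, hv⟩)
    rw [map_sum] at h
    exact h.symm
  rw [hsum, map_sum]
  simp [hdet]

/-! ### The numerical radius of the fundamental operator -/

/-- For `|c| < 1` the operator `(2 c̄ P - S) (2 - c̄ S)⁻¹` is a contraction, as
`‖(2 - c̄ S) x‖² - ‖(2 c̄ P - S) x‖² = (1 - |c|²) (4 ‖x‖² - ‖S x‖²)`. Its adjoint maps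
`(2 - c S*) v` to `-S* v` for `v ∈ ker P*`. -/
theorem norm_star_apply_le_of_norm_lt_one (hP : star P * P = 1) (hS : S = star S * P)
    (hc : Commute S P) (hS2 : ‖S‖ ≤ 2) {c : ℂ} (hc1 : ‖c‖ < 1) {v : H} (hv : star P v = 0) :
    ‖star S v‖ ≤ ‖(2 : ℂ) • v - c • star S v‖ := by
  have hS' : star P * S = star S := by
    conv_rhs => rw [hS]
    rw [star_mul, star_star]
  have hPn : ∀ x, ‖P x‖ = ‖x‖ := fun x => by rw [(norm_map_iff_adjoint_comp_self P).2 hP]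
  set R : H →L[ℂ] H := (2 : ℂ) • 1 - conj c • S with hR
  set G : H →L[ℂ] H := (2 * conj c) • P - S with hG
  have hRG : ∀ x, ‖G x‖ ≤ ‖R x‖ := by
    intro x
    have hip : inner ℂ (P x) (S x) = conj (inner ℂ x (S x)) := by
      rw [← adjoint_inner_right, ← star_eq_adjoint, ← mul_apply_eq_comp, hS', star_eq_adjoint,
        adjoint_inner_right, inner_conj_symm]
    have hre : (c * conj (inner ℂ x (S x))).re = (conj c * inner ℂ x (S x)).re := by
      rw [← Complex.conj_re, map_mul, Complex.conj_conj]
    have h1 : ‖R x‖ ^ 2 = 4 * ‖x‖ ^ 2 - 4 * (conj c * inner ℂ x (S x)).re +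
        ‖c‖ ^ 2 * ‖S x‖ ^ 2 := by
      have h : R x = (2 : ℂ) • x - conj c • S x := rfl
      have h' : inner ℂ ((2 : ℂ) • x) (conj c • S x) =
          ((2 : ℝ) : ℂ) * (conj c * inner ℂ x (S x)) := by
        rw [inner_smul_left, inner_smul_right, map_ofNat]; simp
      rw [h, norm_sub_sq (𝕜 := ℂ), h', norm_smul, norm_smul, RCLike.re_to_complex,
        Complex.norm_conj, Complex.norm_ofNat, Complex.re_ofReal_mul]
      ring
    have h2 : ‖G x‖ ^ 2 = 4 * ‖c‖ ^ 2 * ‖x‖ ^ 2 - 4 * (conj c * inner ℂ x (S x)).re +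
        ‖S x‖ ^ 2 := by
      have h : G x = (2 * conj c) • P x - S x := rfl
      have h' : inner ℂ ((2 * conj c) • P x) (S x) =
          ((2 : ℝ) : ℂ) * (c * conj (inner ℂ x (S x))) := by
        rw [inner_smul_left, hip, map_mul, Complex.conj_conj, map_ofNat, mul_assoc]; simp
      rw [h, norm_sub_sq (𝕜 := ℂ), h', norm_smul, hPn, norm_mul, RCLike.re_to_complex,
        Complex.norm_conj, Complex.norm_ofNat, Complex.re_ofReal_mul, hre]
      ring
    have h3 : ‖S x‖ ^ 2 ≤ 4 * ‖x‖ ^ 2 := by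
      have := le_of_opNorm_le _ hS2 x
      nlinarith [norm_nonneg (S x)]
    refine le_of_sq_le_sq ?_ (norm_nonneg _)
    rw [h1, h2]
    nlinarith [norm_nonneg c, mul_nonneg (sub_nonneg.2 h3)
      (by nlinarith [norm_nonneg c] : (0 : ℝ) ≤ 1 - ‖c‖ ^ 2)]
  have hunit : IsUnit R := by
    have h1 : IsUnit (1 - (conj c / 2) • S) := by
      refine isUnit_one_sub_of_norm_lt_one ?_
      rw [norm_smul, norm_div, Complex.norm_conj, Complex.norm_ofNat]
      nlinarith [norm_nonneg c, norm_nonneg S]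
    have h2 : R = (2 : ℂ) • (1 - (conj c / 2) • S) := by
      rw [smul_sub, smul_smul, mul_div_cancel₀ _ two_ne_zero]
    rw [h2, Algebra.smul_def]
    exact ((IsUnit.mk0 (2 : ℂ) two_ne_zero).map _).mul h1
  obtain ⟨r, hr⟩ := hunit
  have hcomm : Commute R G := by
    refine Commute.sub_left (Commute.smul_left (Commute.one_left _) _) (Commute.smul_left ?_ _)
    exact Commute.sub_right (Commute.smul_right hc _) (Commute.refl _)
  have hT : ‖G * (↑r⁻¹ : H →L[ℂ] H)‖ ≤ 1 := by
    refine opNorm_le_bound _ zero_le_one fun x => ?_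
    rw [one_mul, mul_apply_eq_comp]
    refine (hRG _).trans (le_of_eq ?_)
    rw [← mul_apply_eq_comp, ← hr, Units.mul_inv, one_apply_eq_self]
  have hRT : R * (G * (↑r⁻¹ : H →L[ℂ] H)) = G := by
    rw [← mul_assoc, hcomm.eq, mul_assoc, ← hr, Units.mul_inv, mul_one]
  have hstar : star (G * (↑r⁻¹ : H →L[ℂ] H)) * star R = star G := by rw [← star_mul, hRT]
  have hRv : star R v = (2 : ℂ) • v - c • star S v := by
    simp [hR]
  have hGv : star G v = -star S v := by
    simp [hG, hv]
  rw [← hRv, ← norm_neg, ← hGv, ← hstar, mul_apply_eq_comp]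
  refine (le_of_opNorm_le _ ((norm_star _).le.trans hT) _).trans (by rw [one_mul])

theorem norm_star_apply_le_of_norm_eq_one (hP : star P * P = 1) (hS : S = star S * P)
    (hc : Commute S P) (hS2 : ‖S‖ ≤ 2) {c : ℂ} (hc1 : ‖c‖ = 1) {v : H} (hv : star P v = 0) :
    ‖star S v‖ ≤ ‖(2 : ℂ) • v - c • star S v‖ := by
  have hcont : Continuous fun t : ℝ => ‖(2 : ℂ) • v - ((t : ℂ) * c) • star S v‖ := by fun_prop
  have hlim := (hcont.tendsto 1).mono_left (nhdsWithin_le_nhds (s := Set.Iio 1))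
  simp only [Complex.ofReal_one, one_mul] at hlim
  refine ge_of_tendsto hlim ?_
  filter_upwards [Ioo_mem_nhdsLT (zero_lt_one' ℝ)] with t ht
  refine norm_star_apply_le_of_norm_lt_one hP hS hc hS2 ?_ hv
  rw [norm_mul, hc1, mul_one, Complex.norm_of_nonneg ht.1.le]
  exact ht.2

end Defect

/-! ### Pure `Γ`-isometries with a finite-dimensional defect space -/

section Pure

variable {H : Type u} [NormedAddCommGroup H] [InnerProductSpace ℂ H] [CompleteSpace H]
  {S P : H →L[ℂ] H} {F : defectSpace (adjoint P) →L[ℂ] defectSpace (adjoint P)}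

theorem IsPureGammaIsometry.polyEval_detPoly_eq_zero (h : IsPureGammaIsometry S P)
    [FiniteDimensional ℂ (defectSpace (adjoint P))]
    (hF : IsFundamentalOperator (adjoint S) (adjoint P) F) : polyEval (detPoly F) S P = 0 := by
  have hc : Commute S P := h.1.isGammaContraction.1
  have hP := h.1.star_mul_self
  refine eq_zero_of_commute_of_isPure hP h.2 ?_ fun v hv =>
    polyEval_detPoly_apply_eq_zero hc (apply_coe_defectSpace hP h.1.eq_star_mul
      (hF.coe_apply hP)) hv
  simpa [polyEval, MvPolynomial.X, MvPolynomial.support_monomial] using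
    polyEval_commute hc (detPoly F) (MvPolynomial.X 1)

/-- The numerical radius of the fundamental operator is at most one. -/
theorem IsGammaIsometry.re_mul_inner_le (h : IsGammaIsometry S P)
    (hF : IsFundamentalOperator (adjoint S) (adjoint P) F) (c : ℂ) (hc : ‖c‖ = 1)
    (v : defectSpace (adjoint P)) : (c * inner ℂ v (F v)).re ≤ ‖v‖ ^ 2 := by
  have hP := h.star_mul_self
  have hG := h.isGammaContraction
  have h1 := norm_star_apply_le_of_norm_eq_one hP h.eq_star_mul hG.1 hG.norm_fst_le hc
    ((mem_defectSpace_adjoint_iff hP).1 v.2)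
  rw [star_eq_adjoint, ← hF.coe_apply hP] at h1
  have h2 : ‖F v‖ ^ 2 ≤ ‖(2 : ℂ) • v - c • F v‖ ^ 2 := pow_le_pow_left₀ (norm_nonneg _) h1 2
  have h3 : inner ℂ ((2 : ℂ) • v) (c • F v) = ((2 : ℝ) : ℂ) * (c * inner ℂ v (F v)) := by
    rw [inner_smul_left, inner_smul_right, map_ofNat]; simp
  rw [norm_sub_sq (𝕜 := ℂ), h3, norm_smul, norm_smul, RCLike.re_to_complex,
    Complex.re_ofReal_mul, Complex.norm_ofNat, hc] at h2
  linarith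

theorem IsPureGammaIsometry.isDistinguishedPoly_detPoly [Nontrivial H]
    (h : IsPureGammaIsometry S P) [FiniteDimensional ℂ (defectSpace (adjoint P))]
    (hF : IsFundamentalOperator (adjoint S) (adjoint P) F) (hr : spectralRadius ℂ F < 1) :
    IsDistinguishedPoly (detPoly F) := by
  have : Nontrivial (defectSpace (adjoint P)) := by
    by_contra hV
    rw [not_nontrivial_iff_subsingleton, Submodule.subsingleton_iff_eq_bot] at hV
    -- if the defect space is zero, the identity vanishes on it
    refine one_ne_zero (eq_zero_of_commute_of_isPure h.1.star_mul_self h.2 (Commute.one_left P)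
      fun v hv => ?_)
    rw [hV, Submodule.mem_bot] at hv
    rw [hv, map_zero]
  exact SymBidisc.isDistinguishedPoly_detPoly (h.1.re_mul_inner_le hF) hr

/-- `(F, 0)` is the restriction of `(S*, P*)` to the defect space; the polynomial with the
conjugate coefficients annihilates it. -/
theorem IsGammaDistinguished.of_isGammaIsometry (h : IsGammaIsometry S P)
    (hF : IsFundamentalOperator (adjoint S) (adjoint P) F) (hd : IsGammaDistinguished S P) :
    IsGammaDistinguished F 0 := by
  obtain ⟨hG, p, hp, hp0⟩ := hd
  have hP := h.star_mul_self
  have hP0 : ∀ v : defectSpace (adjoint P),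
      (((0 : defectSpace (adjoint P) →L[ℂ] defectSpace (adjoint P)) v : _) : H) =
        adjoint P v := fun v => ((mem_defectSpace_adjoint_iff hP).1 v.2).symm
  refine ⟨hG.adjoint.restrict (defectSpace (adjoint P)).subtypeₗᵢ (hF.coe_apply hP) hP0,
    conjPoly p, hp.conjPoly, ContinuousLinearMap.ext fun v => Subtype.ext ?_⟩
  have h1 := polyEval_intertwine (S := F) (P := 0) (T := adjoint S) (U := adjoint P)
    (J := (defectSpace (adjoint P)).subtype) (hF.coe_apply hP) hP0 (conjPoly p) v
  rw [← adjoint_polyEval hG.1, hp0, map_zero] at h1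
  exact h1

end Pure

end SymBidisc

theorem mainTheorem1 {H : Type*} [NormedAddCommGroup H] [InnerProductSpace ℂ H] [CompleteSpace H]
    (S P : H →L[ℂ] H) (hSP : SymBidisc.IsPureGammaIsometry S P)
    [FiniteDimensional ℂ (SymBidisc.defectSpace (ContinuousLinearMap.adjoint P))]
    (F : SymBidisc.defectSpace (ContinuousLinearMap.adjoint P) →L[ℂ]
      SymBidisc.defectSpace (ContinuousLinearMap.adjoint P))
    (hF : SymBidisc.IsFundamentalOperator (ContinuousLinearMap.adjoint S)
      (ContinuousLinearMap.adjoint P) F) :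
    [SymBidisc.IsGammaDistinguished F 0,
      SymBidisc.IsGammaDistinguished S P,
      spectralRadius ℂ F < 1].TFAE ∧
    SymBidisc.polyEval (SymBidisc.detPoly F) S P = 0 ∧
    (Nontrivial H → spectralRadius ℂ F < 1 →
      SymBidisc.IsDistinguishedPoly (SymBidisc.detPoly F)) := by
  have hann := hSP.polyEval_detPoly_eq_zero hF
  have hdist : Nontrivial H → spectralRadius ℂ F < 1 →
      SymBidisc.IsDistinguishedPoly (SymBidisc.detPoly F) := fun _ hr =>
    hSP.isDistinguishedPoly_detPoly hF hr
  refine ⟨?_, hann, hdist⟩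
  tfae_have 1 → 3 := SymBidisc.spectralRadius_lt_one_of_isGammaDistinguished
  tfae_have 3 → 2 := fun hr => by
    have hG := hSP.1.isGammaContraction
    rcases subsingleton_or_nontrivial H with hH | hH
    -- on the zero space the determinant is the constant `1`, which has no zeros in `𝔾₂`
    · exact ⟨hG, MvPolynomial.X 0, SymBidisc.isDistinguishedPoly_X_zero, Subsingleton.elim _ _⟩
    · exact ⟨hG, SymBidisc.detPoly F, hdist hH hr, hann⟩
  tfae_have 2 → 1 := fun hd => hd.of_isGammaIsometry hSP.1 hF
  tfae_finish
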